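/- **Proposition 2.1.** Let $k$ be an algebraically closed field of characteristic $0$, let $P=k[x,y,z,t]$ with the standard grading, and let $P_n$ be the space of forms of degree $n$. Write $\mathfrak m=(x,y,z,t)$. An ideal $I\subset P$ is called saturated if every $h\in P$ with $\mathfrak m^N h\subset I$ for some $N\ge 0$ lies in $I$; a homogeneous ideal $I$ is said to have Hilbert polynomial $4n$ if $\dim_k (P/I)_n=4n$ for all sufficiently large $n$ (so that it defines a curve of degree $4$ and arithmetic genus $1$ in $\mathbb P^3_k$). The (Castelnuovo–Mumford) regularity of a homogeneous ideal $I\neq 0$ is the least integer $m$ for which $I$ has a graded free resolution $\cdots\to F_1\to F_0\to I\to 0$ by finitely generated graded free $P$-modules such that $F_i$ is generated in degrees $\le m+i$ for every $i\ge 0$. For an ideal $I\subset P$ the following are equivalent: (a) $I$ is homogeneous and saturated, has Hilbert polynomial $4n$, and has regularity $3$. (b) One of the following holds: 1. $I=(f,g)$ with quadratic forms $f,g\in P_2$ that have no non-constant common divisor; or 2. $I=(\ell\ell_1,\ell\ell_2,f)$, where $\ell,\ell_1,\ell_2\in P_1$ are linear forms, $\ell\ne 0$, $\ell_1,\ell_2$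 are linearly independent, and $f\in P_3$ is a cubic form that lies in the ideal $(\ell_1,\ell_2)$ and is not divisible by $\ell$. -/

import Mathlib

open MvPolynomial Filter

namespace ProjIdeal

variable {σ k : Type*} [Field k]

/-- The ideal `I` of the polynomial ring is saturated: with `𝔪` the ideal generated by the
variables, `𝔪 ^ N * h ⊆ I` for some `N` implies `h ∈ I`. -/
def IsSaturated (I : Ideal (MvPolynomial σ k)) : Prop :=
  ∀ (h : MvPolynomial σ k) (N : ℕ), (∀ g ∈ idealOfVars σ k ^ N, g * h ∈ I) → h ∈ I

/-- The Hilbert function of `P ⧸ I`, `P = k[σ]`: the dimension of the image `(P ⧸ I)_n` of `P_n`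
in `P ⧸ I`. -/
noncomputable def hilbertFunction (I : Ideal (MvPolynomial σ k)) (n : ℕ) : ℕ :=
  Module.finrank k ((homogeneousSubmodule σ k n).map (Ideal.Quotient.mkₐ k I).toLinearMap)

/-- `q` is the Hilbert polynomial of the projective scheme defined by `I`, that is, of `P ⧸ I`. -/
def HasHilbertPolynomial (I : Ideal (MvPolynomial σ k)) (q : Polynomial ℚ) : Prop :=
  ∀ᶠ n : ℕ in atTop, (hilbertFunction I n : ℚ) = q.eval (n : ℚ)

/-- `f` is a form of degree `n`, where `n` is an integer and the only form of negative degree is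
zero. -/
def IsForm (f : MvPolynomial σ k) (n : ℤ) : Prop :=
  f = 0 ∨ ∃ m : ℕ, (m : ℤ) = n ∧ f.IsHomogeneous m

/-- A graded free resolution `⋯ ⟶ F₁ ⟶ F₀ ⟶ I ⟶ 0` of the ideal `I` by finitely generated free
modules `F i = ⨁ j, P(-deg i j)`. The maps have degree zero. -/
structure GradedFreeResolution (I : Ideal (MvPolynomial σ k)) where
  /-- The rank of `F i`. -/
  rank : ℕ → ℕ
  /-- The degree of the `j`-th basis element of `F i`. -/
  deg : ∀ i, Fin (rank i) → ℤ
  /-- The augmentation `F₀ ⟶ I`, as a map to the polynomial ring. -/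
  aug : (Fin (rank 0) → MvPolynomial σ k) →ₗ[MvPolynomial σ k] MvPolynomial σ k
  /-- The differential `F (i + 1) ⟶ F i`. -/
  d : ∀ i, (Fin (rank (i + 1)) → MvPolynomial σ k) →ₗ[MvPolynomial σ k]
    (Fin (rank i) → MvPolynomial σ k)
  isForm_aug : ∀ j, IsForm (aug (Pi.single j 1)) (deg 0 j)
  isForm_d : ∀ i j l, IsForm (d i (Pi.single j 1) l) (deg (i + 1) j - deg i l)
  range_aug : LinearMap.range aug = I
  exact_zero : LinearMap.range (d 0) = LinearMap.ker aug
  exact_succ : ∀ i, LinearMap.range (d (i + 1)) = LinearMap.ker (d i)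

/-- `I` is `m`-regular (in the sense of Castelnuovo and Mumford): it has a graded free resolution
whose `i`-th module is generated in degrees at most `m + i`. -/
def IsRegular (I : Ideal (MvPolynomial σ k)) (m : ℤ) : Prop :=
  ∃ R : GradedFreeResolution I, ∀ i j, R.deg i j ≤ m + i

/-- The Castelnuovo-Mumford regularity of `I` is `r`: `r` is the least integer `m` such that `I`
is `m`-regular. -/
def HasRegularity (I : Ideal (MvPolynomial σ k)) (r : ℤ) : Prop :=
  IsLeast {m : ℤ | IsRegular I m} r

end ProjIdeal

attribute [local instance] MvPolynomial.gradedAlgebra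

/-! Write P for the polynomial ring and P_n, I_n, J_n for the forms of degree n, in P and in ideals
I, J.

From (a) to (b), the point is that the Hilbert function of P/I already equals 4n for n ≥ 2. For a
resolution F of I, of any length, dim I_n = dim (F₀)_n - dim (F₁)_n + dim K_n, where K is the kernel
of F₁ → F₀. As I is saturated, the four variables form a regular sequence on K (`isVarRegular_ker`),
so the fourth difference of dim K_n is the dimension of K/(x,y,z,t)K in degree n, which vanishes
above the degrees of the generators of F₂. Thus the fourth difference of dim I_n vanishes for n > 5
(`fourthDiff_finrank_idealPiece`), and the Hilbert polynomial propagates from large degrees down to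
n = 2.

Hence dim I_n = 2, 8, 19 for n = 2, 3, 4, and I is generated in degrees at most 3. Two independent
quadrics of I are either coprime, and then generate I by a dimension count, or equal to ℓℓ₁, ℓℓ₂. In
the latter case J = (ℓℓ₁, ℓℓ₂) has dimensions 2, 7, 16, so one cubic f is missing. If ℓ divided f,
then I ⊆ (ℓ) would be too large. Since 16 + 4 > 19, some linear multiple of f lies in J; it is a
scalar multiple of ℓf, whence f ∈ (ℓ₁, ℓ₂) (`exists_generators_of_finrank`).

From (b) to (a), both ideals have explicit resolutions of length one, Koszul and Hilbert–Burch,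
which give saturation, the Hilbert polynomial and 3-regularity. 2-regularity fails because the
Koszul syzygy of two coprime quadrics has degree 4, and because f is not generated by quadrics of
the ideal. -/

namespace ProjIdeal

/-! ### Forms and homogeneous components in integral degrees -/

section Forms

variable {σ k : Type*} [Field k]

/-- The forms of integral degree `n`. -/
noncomputable def forms (σ k : Type*) [Field k] (n : ℤ) : Submodule k (MvPolynomial σ k) :=
  if 0 ≤ n then homogeneousSubmodule σ k n.toNat else ⊥

/-- The component of integral degree `n`. -/
noncomputable def comp (n : ℤ) : MvPolynomial σ k →ₗ[k] MvPolynomial σ k :=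
  if 0 ≤ n then homogeneousComponent n.toNat else 0

theorem forms_natCast (n : ℕ) : forms σ k n = homogeneousSubmodule σ k n := by
  simp [forms]

theorem mem_forms_natCast {n : ℕ} {f : MvPolynomial σ k} :
    f ∈ forms σ k n ↔ f.IsHomogeneous n := by
  rw [forms_natCast, mem_homogeneousSubmodule]

theorem forms_of_neg {n : ℤ} (hn : n < 0) : forms σ k n = ⊥ := by
  simp [forms, not_le.2 hn]

theorem mem_forms {n : ℤ} {f : MvPolynomial σ k} : f ∈ forms σ k n ↔ IsForm f n := by
  rcases lt_or_ge n 0 with hn | hn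
  · rw [forms_of_neg hn, Submodule.mem_bot, IsForm]
    refine ⟨Or.inl, ?_⟩
    rintro (h | ⟨m, hm, -⟩)
    · exact h
    · omega
  · lift n to ℕ using hn
    rw [mem_forms_natCast, IsForm]
    refine ⟨fun h => Or.inr ⟨n, rfl, h⟩, ?_⟩
    rintro (rfl | ⟨m, hm, h⟩)
    · exact isHomogeneous_zero _ _ _
    · obtain rfl : m = n := by exact_mod_cast hm
      exact h

theorem comp_mem (n : ℤ) (f : MvPolynomial σ k) : comp n f ∈ forms σ k n := by
  rcases lt_or_ge n 0 with hn | hn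
  · simp [comp, not_le.2 hn]
  · simp only [comp, forms, hn, if_true]
    exact homogeneousComponent_mem n.toNat f

theorem comp_of_mem {n : ℤ} {f : MvPolynomial σ k} (hf : f ∈ forms σ k n) : comp n f = f := by
  rcases lt_or_ge n 0 with hn | hn
  · rw [forms_of_neg hn, Submodule.mem_bot] at hf
    simp [hf]
  · simp only [comp, forms, hn, if_true] at hf ⊢
    rw [homogeneousComponent_of_mem hf, if_pos rfl]

theorem comp_of_mem_ne {m n : ℤ} {f : MvPolynomial σ k} (hf : f ∈ forms σ k m) (h : n ≠ m) :
    comp n f = 0 := by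
  rcases lt_or_ge m 0 with hm | hm
  · rw [forms_of_neg hm, Submodule.mem_bot] at hf
    simp [hf]
  rcases lt_or_ge n 0 with hn | hn
  · simp [comp, not_le.2 hn]
  · simp only [comp, forms, hn, hm, if_true] at hf ⊢
    rw [homogeneousComponent_of_mem hf, if_neg (by omega)]

theorem mul_mem_forms {m n : ℤ} {f g : MvPolynomial σ k} (hf : f ∈ forms σ k m)
    (hg : g ∈ forms σ k n) : f * g ∈ forms σ k (m + n) := by
  rw [mem_forms] at *
  rcases hf with rfl | ⟨a, rfl, hf⟩
  · exact Or.inl (zero_mul _)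
  rcases hg with rfl | ⟨b, rfl, hg⟩
  · exact Or.inl (mul_zero _)
  exact Or.inr ⟨a + b, by push_cast; rfl, hf.mul hg⟩

theorem X_mem_forms (i : σ) : (X i : MvPolynomial σ k) ∈ forms σ k 1 :=
  mem_forms_natCast (n := 1).2 (isHomogeneous_X k i)

theorem X_mul_mem_forms {n : ℤ} {f : MvPolynomial σ k} (i : σ) (hf : f ∈ forms σ k n) :
    X i * f ∈ forms σ k (n + 1) := by
  rw [add_comm]
  exact mul_mem_forms (X_mem_forms i) hf

theorem monomial_mem_forms (d : σ →₀ ℕ) (r : k) : monomial d r ∈ forms σ k d.degree :=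
  mem_forms_natCast.2 (isHomogeneous_monomial r rfl)

theorem comp_mul {d : ℤ} {c : MvPolynomial σ k} (hc : c ∈ forms σ k d) (n : ℤ)
    (f : MvPolynomial σ k) : comp (n + d) (c * f) = c * comp n f := by
  induction f using MvPolynomial.induction_on' with
  | monomial u a =>
    have h1 := mul_mem_forms hc (monomial_mem_forms u a)
    by_cases h : n = u.degree
    · subst h
      rw [comp_of_mem (monomial_mem_forms u a), comp_of_mem (by rwa [add_comm] at h1)]
    · rw [comp_of_mem_ne (monomial_mem_forms u a) h, comp_of_mem_ne h1 (by omega), mul_zero]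
  | add f g hf hg => rw [mul_add, map_add, map_add, mul_add, hf, hg]

theorem mem_of_comp_mem {S : Type*} [SetLike S (MvPolynomial σ k)]
    [AddSubmonoidClass S (MvPolynomial σ k)] {I : S} {f : MvPolynomial σ k}
    (h : ∀ n : ℕ, comp n f ∈ I) : f ∈ I := by
  rw [← sum_homogeneousComponent f]
  exact sum_mem fun i _ => by simpa [comp] using h i

theorem comp_mem_of_isHomogeneous {I : Ideal (MvPolynomial σ k)}
    (hI : I.IsHomogeneous (homogeneousSubmodule σ k)) {f : MvPolynomial σ k} (hf : f ∈ I) (n : ℤ) :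
    comp n f ∈ I := by
  unfold comp
  split_ifs
  · exact homogeneousComponent_mem_of_mem hI hf _
  · simp

/-- No monomial of positive degree is constant, so f lies in the ideal of the variables; taking
components makes the coefficients homogeneous. -/
theorem exists_eq_sum_X_mul [Fintype σ] {n : ℤ} (hn : 0 < n) {f : MvPolynomial σ k}
    (hf : f ∈ forms σ k n) :
    ∃ g : σ → MvPolynomial σ k, (∀ i, g i ∈ forms σ k (n - 1)) ∧ f = ∑ i, X i * g i := by
  lift n to ℕ using hn.le
  have hf' := mem_forms_natCast.1 hf
  have h : f ∈ Ideal.span (Set.range (X : σ → MvPolynomial σ k)) := by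
    rw [← Set.image_univ, mem_ideal_span_X_image]
    intro m hm
    by_contra! h
    have := hf'.degree_eq_sum_deg_support hm
    have h0 : m = 0 := Finsupp.ext fun i => h i trivial
    subst h0
    simp at this
    omega
  obtain ⟨c, hc⟩ := (Ideal.mem_span_range_iff_exists_fun).1 h
  refine ⟨fun i => comp (n - 1) (c i), fun i => comp_mem _ _, ?_⟩
  have h2 : comp n f = f := comp_of_mem hf
  rw [← h2, ← hc, map_sum]
  refine Finset.sum_congr rfl fun i _ => ?_
  rw [← comp_mul (X_mem_forms i), sub_add_cancel, mul_comm]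

instance finite_forms [Finite σ] (n : ℤ) : Module.Finite k (forms σ k n) := by
  rcases lt_or_ge n 0 with hn | hn
  · rw [forms_of_neg hn]
    infer_instance
  · lift n to ℕ using hn
    rw [forms_natCast]
    exact Module.Finite.iff_fg.2 (homogeneousSubmodule_fg _ _ _)

end Forms

/-! ### Dimensions of the spaces of forms -/

section FinrankForms

variable {k : Type*} [Field k]

theorem finrank_homogeneousSubmodule (n : ℕ) :
    Module.finrank k (homogeneousSubmodule (Fin 4) k n) = (n + 3).choose 3 := by
  have h : {d : Fin 4 →₀ ℕ | d.degree = n} =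
      (Finset.univ.finsuppAntidiag n : Finset (Fin 4 →₀ ℕ)) := by
    ext d
    simp [Finset.mem_finsuppAntidiag, Finsupp.degree_eq_sum]
  have h2 := Finset.card_finsuppAntidiag_nat_eq_choose (s := (Finset.univ : Finset (Fin 4))) n
  rw [homogeneousSubmodule_eq_finsupp_supported, h,
    (AddMonoidAlgebra.supportedEquivFinsupp _).finrank_eq, Module.finrank_finsupp_self]
  simp only [SetLike.coe_sort_coe, Fintype.card_coe]
  rw [h2, Finset.card_univ, Fintype.card_fin, show 4 + n - 1 = n + 3 by omega,
    Nat.choose_symm_add]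

/-- The cubic polynomial vanishes at -1, -2 and -3, so the formula survives slightly below degree
zero. These three extra degrees give the sharp range for fourth differences. -/
theorem six_mul_finrank_forms {n : ℤ} (hn : -3 ≤ n) :
    6 * (Module.finrank k (forms (Fin 4) k n) : ℤ) = (n + 3) * (n + 2) * (n + 1) := by
  rcases lt_or_ge n 0 with h | h
  · rw [forms_of_neg h]
    have : n = -3 ∨ n = -2 ∨ n = -1 := by omega
    rcases this with rfl | rfl | rfl <;> simp
  · lift n to ℕ using h
    rw [forms_natCast, finrank_homogeneousSubmodule]
    have h1 : (n + 3).choose 3 * 6 = (n + 3) * (n + 2) * (n + 1) := by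
      have := Nat.descFactorial_eq_factorial_mul_choose (n + 3) 3
      simp [Nat.descFactorial, Nat.factorial] at this
      rw [mul_comm, ← this]; ring
    rw [mul_comm]
    exact_mod_cast h1

end FinrankForms

/-! ### Graded pieces of free modules -/

section Vectors

variable {σ k ι κ : Type*} [Field k]

/-- The vectors of degree `n` in the graded free module with basis elements of degrees `a`. -/
noncomputable def piece (a : ι → ℤ) (n : ℤ) : Submodule k (ι → MvPolynomial σ k) :=
  Submodule.pi Set.univ fun j => forms σ k (n - a j)

/-- The component of degree `n` in the graded free module with basis elements of degrees `a`. -/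
noncomputable def vcomp (a : ι → ℤ) (n : ℤ) :
    (ι → MvPolynomial σ k) →ₗ[k] (ι → MvPolynomial σ k) :=
  LinearMap.pi fun j => comp (n - a j) ∘ₗ LinearMap.proj j

theorem mem_piece {a : ι → ℤ} {n : ℤ} {u : ι → MvPolynomial σ k} :
    u ∈ piece a n ↔ ∀ j, u j ∈ forms σ k (n - a j) := by
  simp [piece]

theorem vcomp_apply (a : ι → ℤ) (n : ℤ) (u : ι → MvPolynomial σ k) (j : ι) :
    vcomp a n u j = comp (n - a j) (u j) := rfl

theorem vcomp_mem (a : ι → ℤ) (n : ℤ) (u : ι → MvPolynomial σ k) : vcomp a n u ∈ piece a n :=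
  mem_piece.2 fun _ => comp_mem _ _

theorem vcomp_of_mem {a : ι → ℤ} {n : ℤ} {u : ι → MvPolynomial σ k} (hu : u ∈ piece a n) :
    vcomp a n u = u :=
  funext fun j => comp_of_mem (mem_piece.1 hu j)

theorem vcomp_X_smul (a : ι → ℤ) (n : ℤ) (i : σ) (u : ι → MvPolynomial σ k) :
    vcomp a n ((X i : MvPolynomial σ k) • u) = (X i : MvPolynomial σ k) • vcomp a (n - 1) u := by
  ext1 j
  rw [vcomp_apply, Pi.smul_apply, Pi.smul_apply, vcomp_apply, smul_eq_mul, smul_eq_mul,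
    ← comp_mul (X_mem_forms i)]
  congr 2
  ring

theorem X_smul_mem_piece {a : ι → ℤ} {n : ℤ} {u : ι → MvPolynomial σ k} (i : σ)
    (hu : u ∈ piece a n) : (X i : MvPolynomial σ k) • u ∈ piece a (n + 1) :=
  mem_piece.2 fun j => by
    have := X_mul_mem_forms i (mem_piece.1 hu j)
    rwa [show n - a j + 1 = n + 1 - a j by ring] at this

theorem exists_eq_sum_X_smul [Fintype σ] {a : ι → ℤ} {n : ℤ} (hn : ∀ j, a j < n)
    {u : ι → MvPolynomial σ k} (hu : u ∈ piece a n) :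
    ∃ v : σ → ι → MvPolynomial σ k, (∀ i, v i ∈ piece a (n - 1)) ∧
      u = ∑ i, (X i : MvPolynomial σ k) • v i := by
  choose g hg hg' using fun j =>
    exists_eq_sum_X_mul (sub_pos.2 (hn j)) (mem_piece.1 hu j)
  refine ⟨fun i j => g j i, fun i => mem_piece.2 fun j => ?_, funext fun j => ?_⟩
  · rw [sub_right_comm]
    exact hg j i
  · rw [hg' j]
    simp

/-- A linear form on a graded free module that is homogeneous commutes with taking components. -/
theorem comp_apply_of_forms [Fintype ι] [DecidableEq ι] {a : ι → ℤ} {b : ℤ}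
    {φ : (ι → MvPolynomial σ k) →ₗ[MvPolynomial σ k] MvPolynomial σ k}
    (hφ : ∀ j, φ (Pi.single j 1) ∈ forms σ k (a j - b)) (n : ℤ) (u : ι → MvPolynomial σ k) :
    comp (n - b) (φ u) = φ (vcomp a n u) := by
  have h : ∀ v, φ v = ∑ j, φ (Pi.single j 1) * v j := fun v => by
    conv_lhs => rw [pi_eq_sum_univ' v]
    simp [mul_comm]
  rw [h, h, map_sum]
  refine Finset.sum_congr rfl fun j _ => ?_
  rw [vcomp_apply, ← comp_mul (hφ j)]
  congr 1
  ring_nf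

theorem vcomp_apply_of_forms [Fintype ι] [DecidableEq ι] {a : ι → ℤ} {b : κ → ℤ}
    {φ : (ι → MvPolynomial σ k) →ₗ[MvPolynomial σ k] (κ → MvPolynomial σ k)}
    (hφ : ∀ j l, φ (Pi.single j 1) l ∈ forms σ k (a j - b l)) (n : ℤ)
    (u : ι → MvPolynomial σ k) : vcomp b n (φ u) = φ (vcomp a n u) :=
  _root_.funext fun l => comp_apply_of_forms
    (φ := (LinearMap.proj l : (κ → MvPolynomial σ k) →ₗ[MvPolynomial σ k] _) ∘ₗ φ)
    (fun j => hφ j l) n u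

/-- The product of submodules is the product of modules. -/
def piUnivEquiv {ι : Type*} {V : ι → Type*} [∀ i, AddCommGroup (V i)] [∀ i, Module k (V i)]
    (p : ∀ i, Submodule k (V i)) : Submodule.pi Set.univ p ≃ₗ[k] ∀ i, p i where
  toFun u i := ⟨u.1 i, u.2 i trivial⟩
  invFun u := ⟨fun i => u i, fun i _ => (u i).2⟩
  map_add' _ _ := rfl
  map_smul' _ _ := rfl
  left_inv _ := rfl
  right_inv _ := rfl

instance finite_piece [Finite σ] [Finite ι] (a : ι → ℤ) (n : ℤ) :
    Module.Finite k (piece (σ := σ) (k := k) a n) :=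
  Module.Finite.equiv (piUnivEquiv fun j => forms σ k (n - a j)).symm

theorem finrank_piece [Finite σ] [Fintype ι] (a : ι → ℤ) (n : ℤ) :
    Module.finrank k (piece (σ := σ) (k := k) a n) =
      ∑ j, Module.finrank k (forms σ k (n - a j)) := by
  rw [piece, (piUnivEquiv _).finrank_eq, Module.finrank_pi_fintype]

/-- Rank-nullity in one degree. Because φ commutes with the projections π and ρ, every element of
its range lying in B is already the image of an element of A. -/
theorem finrank_eq_of_commute {V W : Type*} [AddCommGroup V] [Module k V] [AddCommGroup W]
    [Module k W] {φ : V →ₗ[k] W} {π : V →ₗ[k] V} {ρ : W →ₗ[k] W} {A : Submodule k V}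
    {B : Submodule k W} [Module.Finite k A] (hπ : ∀ v, π v ∈ A) (hA : ∀ v ∈ A, φ v ∈ B)
    (hB : ∀ w ∈ B, ρ w = w) (h : ∀ v, ρ (φ v) = φ (π v)) :
    Module.finrank k A = Module.finrank k (LinearMap.ker φ ⊓ A : Submodule k V) +
      Module.finrank k (LinearMap.range φ ⊓ B : Submodule k W) := by
  have h1 : LinearMap.range φ ⊓ B = A.map φ := by
    ext w
    constructor
    · rintro ⟨⟨v, rfl⟩, hw⟩
      exact ⟨π v, hπ v, by rw [← h, hB _ hw]⟩
    · rintro ⟨v, hv, rfl⟩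
      exact ⟨⟨v, rfl⟩, hA v hv⟩
  rw [h1]
  have h2 := LinearMap.finrank_range_add_finrank_ker (φ.domRestrict A)
  rw [LinearMap.range_domRestrict] at h2
  have h3 : Module.finrank k (LinearMap.ker (φ.domRestrict A)) =
      Module.finrank k (LinearMap.ker φ ⊓ A : Submodule k V) := by
    rw [LinearMap.ker_domRestrict, inf_comm, ← Submodule.map_comap_subtype,
      Submodule.finrank_map_subtype_eq]
  omega

end Vectors
-- Exactness of the Koszul complex of the variables
section Koszul

variable {σ k ι : Type*} [Field k]

theorem exists_of_X_mul_add_eq_zero {i j : σ} (hij : i ≠ j) {a b : MvPolynomial σ k}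
    (h : X i * a + X j * b = 0) : ∃ c, a = X j * c ∧ b = -(X i * c) := by
  have h1 : X j ∣ X i * a := ⟨-b, by linear_combination h⟩
  rw [X_dvd_mul_iff, X_dvd_X] at h1
  obtain ⟨c, rfl⟩ := h1.resolve_left fun h => hij h.symm
  refine ⟨c, rfl, mul_left_cancel₀ (X_ne_zero (R := k) j) ?_⟩
  linear_combination h

/-- Membership in a monomial ideal is tested on monomials, and a factor `X j` with j outside s
contributes no variable of s. -/
theorem mem_span_X_of_X_mul_mem {s : Set σ} {j : σ} (hj : j ∉ s) {u : MvPolynomial σ k}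
    (h : X j * u ∈ Ideal.span (X '' s : Set (MvPolynomial σ k))) :
    u ∈ Ideal.span (X '' s : Set (MvPolynomial σ k)) := by
  rw [mem_ideal_span_X_image] at h ⊢
  intro m hm
  obtain ⟨i, hi, h1⟩ := h (Finsupp.single j 1 + m) (by
    rw [mem_support_iff, coeff_X_mul]
    exact mem_support_iff.1 hm)
  refine ⟨i, hi, ?_⟩
  have : j ≠ i := fun h => hj (h ▸ hi)
  simpa [Finsupp.single_apply, this] using h1

theorem exists_of_X_mul_eq₂ {i j l : σ} (hil : l ≠ i) (hjl : l ≠ j) {u v w : MvPolynomial σ k}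
    (h : X l * u = X i * v + X j * w) : ∃ a b, u = X i * a + X j * b := by
  have h1 := mem_span_X_of_X_mul_mem (k := k) (s := {i, j}) (j := l) (u := u)
    (by simp [hil, hjl]) (by
    rw [Set.image_pair, Ideal.mem_span_pair]
    exact ⟨v, w, by rw [h]; ring⟩)
  rw [Set.image_pair, Ideal.mem_span_pair] at h1
  obtain ⟨a, b, h⟩ := h1
  exact ⟨a, b, by rw [← h]; ring⟩

theorem exists_of_X_mul_eq₃ {i j l m : σ} (him : m ≠ i) (hjm : m ≠ j) (hlm : m ≠ l)
    {u v w z : MvPolynomial σ k} (h : X m * u = X i * v + X j * w + X l * z) :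
    ∃ a b c, u = X i * a + X j * b + X l * c := by
  have h1 := mem_span_X_of_X_mul_mem (k := k) (s := {i, j, l}) (j := m) (u := u)
    (by simp [him, hjm, hlm]) (by
    rw [Set.image_insert_eq, Set.image_pair, Submodule.mem_span_triple]
    exact ⟨v, w, z, by rw [h]; simp only [smul_eq_mul]; ring⟩)
  rw [Set.image_insert_eq, Set.image_pair, Submodule.mem_span_triple] at h1
  obtain ⟨a, b, c, h⟩ := h1
  exact ⟨a, b, c, by rw [← h]; simp only [smul_eq_mul]; ring⟩

/-- The last coefficient lies in the ideal of the other two variables; subtracting the corresponding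
Koszul relations leaves a relation between two variables. -/
theorem exists_of_X_mul_add_add_eq_zero {i j l : σ} (hij : i ≠ j) (hil : i ≠ l) (hjl : j ≠ l)
    {a b c : MvPolynomial σ k}
    (h : X i * a + X j * b + X l * c = 0) :
    ∃ p q r, a = X j * p + X l * q ∧ b = -(X i * p) + X l * r ∧ c = -(X i * q) - X j * r := by
  obtain ⟨s, t, hc⟩ := exists_of_X_mul_eq₂ (k := k) hil.symm hjl.symm (u := c) (v := -a) (w := -b)
    (by linear_combination h)
  obtain ⟨p, h1, h2⟩ := exists_of_X_mul_add_eq_zero hij (a := a + X l * s) (b := b + X l * t)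
    (by rw [hc] at h; linear_combination h)
  exact ⟨p, -s, -t, by linear_combination h1, by linear_combination h2, by rw [hc]; ring⟩

theorem exists_of_X_mul_cycle {i j l : σ} (hjl : j ≠ l) {p q r : MvPolynomial σ k}
    (h1 : X j * p + X l * q = 0)
    (h2 : -(X i * p) + X l * r = 0) : ∃ e, p = X l * e ∧ q = -(X j * e) ∧ r = X i * e := by
  obtain ⟨e, rfl, rfl⟩ := exists_of_X_mul_add_eq_zero hjl h1
  refine ⟨e, rfl, rfl, mul_left_cancel₀ (X_ne_zero (R := k) l) ?_⟩
  linear_combination h2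

end Koszul

/-! ### Depth of syzygy modules -/

section Vectors

variable {k ι : Type*} [Field k]

local notation "P" => MvPolynomial (Fin 4) k

theorem X_smul_injective (i : Fin 4) {u v : ι → P} (h : (X i : P) • u = (X i : P) • v) : u = v :=
  _root_.funext fun j => mul_left_cancel₀ (X_ne_zero (R := k) i) (congrFun h j)

theorem exists_of_smul_eq₁ {u v : ι → P} (h : (X 1 : P) • u = (X 0 : P) • v) :
    ∃ a : ι → P, u = (X 0 : P) • a := by
  choose a h1 _ using fun t => exists_of_X_mul_add_eq_zero (k := k) (i := (1 : Fin 4)) (j := 0)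
    (by decide) (a := u t) (b := -v t) (by have := congrFun h t; simp at this; rw [this]; ring)
  exact ⟨a, _root_.funext h1⟩

theorem exists_of_smul_eq₂ {u v w : ι → P} (h : (X 2 : P) • u = (X 0 : P) • v + (X 1 : P) • w) :
    ∃ a b : ι → P, u = (X 0 : P) • a + (X 1 : P) • b := by
  choose a b h1 using fun t => exists_of_X_mul_eq₂ (k := k) (l := (2 : Fin 4)) (i := 0) (j := 1)
    (by decide) (by decide) (congrFun h t)
  exact ⟨a, b, _root_.funext h1⟩

theorem exists_of_smul_eq₃ {u v w z : ι → P}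
    (h : (X 3 : P) • u = (X 0 : P) • v + (X 1 : P) • w + (X 2 : P) • z) :
    ∃ a b c : ι → P, u = (X 0 : P) • a + (X 1 : P) • b + (X 2 : P) • c := by
  choose a b c h1 using fun t => exists_of_X_mul_eq₃ (k := k) (m := (3 : Fin 4)) (i := 0) (j := 1)
    (l := 2) (by decide) (by decide) (by decide) (congrFun h t)
  exact ⟨a, b, c, _root_.funext h1⟩

theorem exists_of_smul_add_eq_zero {a b : ι → P} (h : (X 0 : P) • a + (X 1 : P) • b = 0) :
    ∃ c : ι → P, a = (X 1 : P) • c ∧ b = -((X 0 : P) • c) := by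
  choose c h1 h2 using fun t => exists_of_X_mul_add_eq_zero (k := k) (i := (0 : Fin 4)) (j := 1)
    (by decide) (congrFun h t)
  exact ⟨c, _root_.funext h1, _root_.funext h2⟩

theorem exists_of_smul_add_add_eq_zero {a b c : ι → P}
    (h : (X 0 : P) • a + (X 1 : P) • b + (X 2 : P) • c = 0) :
    ∃ p q r : ι → P, a = (X 1 : P) • p + (X 2 : P) • q ∧ b = -((X 0 : P) • p) + (X 2 : P) • r ∧
      c = -((X 0 : P) • q) - (X 1 : P) • r := by
  choose p q r h1 h2 h3 using fun t => exists_of_X_mul_add_add_eq_zero (k := k) (i := (0 : Fin 4))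
    (j := 1) (l := 2) (by decide) (by decide) (by decide) (congrFun h t)
  exact ⟨p, q, r, _root_.funext h1, _root_.funext h2, _root_.funext h3⟩

theorem exists_of_smul_cycle {p q r : ι → P} (h1 : (X 1 : P) • p + (X 2 : P) • q = 0)
    (h2 : -((X 0 : P) • p) + (X 2 : P) • r = 0) :
    ∃ e : ι → P, p = (X 2 : P) • e ∧ q = -((X 1 : P) • e) ∧ r = (X 0 : P) • e := by
  choose e h1 h2 h3 using fun t => exists_of_X_mul_cycle (k := k) (i := (0 : Fin 4))
    (j := 1) (l := 2) (by decide) (congrFun h1 t) (congrFun h2 t)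
  exact ⟨e, _root_.funext h1, _root_.funext h2, _root_.funext h3⟩

/-- The sequence of the variables is regular on the submodule `K` of a free module. -/
structure IsVarRegular (K : Submodule P (ι → P)) : Prop where
  reg₁ : ∀ u ∈ K, ∀ v ∈ K, (X 1 : P) • u = (X 0 : P) • v → ∃ a ∈ K, u = (X 0 : P) • a
  reg₂ : ∀ u ∈ K, ∀ v ∈ K, ∀ w ∈ K, (X 2 : P) • u = (X 0 : P) • v + (X 1 : P) • w →
    ∃ a ∈ K, ∃ b ∈ K, u = (X 0 : P) • a + (X 1 : P) • b
  reg₃ : ∀ u ∈ K, ∀ v ∈ K, ∀ w ∈ K, ∀ z ∈ K,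
    (X 3 : P) • u = (X 0 : P) • v + (X 1 : P) • w + (X 2 : P) • z →
    ∃ a ∈ K, ∃ b ∈ K, ∃ c ∈ K, u = (X 0 : P) • a + (X 1 : P) • b + (X 2 : P) • c

variable {κ : Type*}

/-- A second module of syzygies of an ideal of depth at least two is a maximal Cohen-Macaulay
module. -/
theorem isVarRegular_ker {φ : (ι → P) →ₗ[P] (κ → P)} {ψ : (κ → P) →ₗ[P] P}
    (hex : LinearMap.range φ = LinearMap.ker ψ)
    (hsat : ∀ e : P, (∀ i : Fin 4, X i * e ∈ LinearMap.range ψ) → e ∈ LinearMap.range ψ) :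
    IsVarRegular (LinearMap.ker φ) := by
  have hψφ : ∀ u, ψ (φ u) = 0 := fun u => by
    rw [← LinearMap.mem_ker, ← hex]
    exact ⟨u, rfl⟩
  have hlift : ∀ c, ψ c = 0 → ∃ u, φ u = c := fun c hc => by
    rw [← LinearMap.mem_ker, ← hex] at hc
    exact hc
  have hψX : ∀ (i : Fin 4) (c : κ → P), (X i : P) * ψ c = 0 → ψ c = 0 := fun i c h =>
    (mul_eq_zero.1 h).resolve_left (X_ne_zero i)
  refine ⟨?_, ?_, ?_⟩
  · intro u hu v hv h
    obtain ⟨a, rfl⟩ := exists_of_smul_eq₁ h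
    refine ⟨a, ?_, rfl⟩
    rw [LinearMap.mem_ker, map_smul] at hu
    refine X_smul_injective 0 ?_
    rw [hu, smul_zero]
  · intro u hu v hv w hw h
    obtain ⟨a, b, rfl⟩ := exists_of_smul_eq₂ h
    rw [LinearMap.mem_ker, map_add, map_smul, map_smul] at hu
    obtain ⟨c, hc1, hc2⟩ := exists_of_smul_add_eq_zero hu
    -- A variable times ψ c vanishes in a domain, so c is a syzygy and lifts; its lift corrects a
    -- and b by a Koszul relation.
    obtain ⟨c', rfl⟩ := hlift c (hψX 1 c (by
      rw [← smul_eq_mul, ← map_smul, ← hc1, hψφ]))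
    refine ⟨a - (X 1 : P) • c', ?_, b + (X 0 : P) • c', ?_, ?_⟩
    · rw [LinearMap.mem_ker, map_sub, map_smul, hc1, sub_self]
    · rw [LinearMap.mem_ker, map_add, map_smul, hc2, neg_add_cancel]
    · module
  · intro u hu v hv w hw z hz h
    obtain ⟨a, b, c, rfl⟩ := exists_of_smul_eq₃ h
    rw [LinearMap.mem_ker] at hu hv hw hz
    simp only [map_add, map_smul] at hu
    obtain ⟨p, q, r, hp, hq, hr⟩ := exists_of_smul_add_add_eq_zero hu
    have e1 : (X 1 : P) * ψ p + X 2 * ψ q = 0 := by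
      simpa [hψφ] using (congrArg ψ hp).symm
    have e2 : -((X 0 : P) * ψ p) + X 2 * ψ r = 0 := by
      simpa [hψφ] using (congrArg ψ hq).symm
    obtain ⟨e, hep, heq, her⟩ := exists_of_X_mul_cycle (by decide) e1 e2
    obtain ⟨p₁, q₁, r₁, h1, h2, h3⟩ := exists_of_smul_add_add_eq_zero
      (a := (X 3 : P) • a - v) (b := (X 3 : P) • b - w) (c := (X 3 : P) • c - z) (by
        linear_combination (norm := module) h)
    replace h1 := congrArg φ h1
    replace h2 := congrArg φ h2
    replace h3 := congrArg φ h3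
    simp only [map_add, map_sub, map_neg, map_smul, hv, hw, hz, hp, hq, hr] at h1 h2 h3
    obtain ⟨g, hg, -, -⟩ := exists_of_smul_cycle (p := (X 3 : P) • p - φ p₁)
      (q := (X 3 : P) • q - φ q₁) (r := (X 3 : P) • r - φ r₁)
      (by linear_combination (norm := module) h1) (by linear_combination (norm := module) h2)
    -- The hypothesis on `X 3 • u` kills the obstruction after multiplication by `X 3`. The other
    -- variables kill it by construction, so `hsat` applies.
    have h3e : X 3 * e = ψ g := by
      refine mul_left_cancel₀ (X_ne_zero (R := k) 2) ?_
      have := congrArg ψ hg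
      simp only [map_sub, map_smul, hψφ, smul_eq_mul, hep] at this
      linear_combination this
    obtain ⟨e', rfl⟩ := hsat e (by
      intro i
      fin_cases i
      · exact ⟨r, her⟩
      · exact ⟨-q, by rw [map_neg, heq, neg_neg]; rfl⟩
      · exact ⟨p, hep⟩
      · exact ⟨g, h3e.symm⟩)
    -- Once e is a value of ψ, changing p, q, r by a Koszul cycle built on e' makes them syzygies,
    -- which lift.
    obtain ⟨p', hp'⟩ := hlift (p - (X 2 : P) • e') (by simp [hep])
    obtain ⟨q', hq'⟩ := hlift (q + (X 1 : P) • e') (by simp [heq])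
    obtain ⟨r', hr'⟩ := hlift (r - (X 0 : P) • e') (by simp [her])
    refine ⟨a - (X 1 : P) • p' - (X 2 : P) • q', ?_, b + (X 0 : P) • p' - (X 2 : P) • r', ?_,
      c + (X 0 : P) • q' + (X 1 : P) • r', ?_, ?_⟩
    · simp only [LinearMap.mem_ker, map_sub, map_smul, hp', hq', hp]
      module
    · simp only [LinearMap.mem_ker, map_add, map_sub, map_smul, hp', hr', hq]
      module
    · simp only [LinearMap.mem_ker, map_add, map_smul, hq', hr', hr]
      module
    · module

/-- A resolution of length one leaves no socle in the quotient. Lifts u i of `X i * e` differ by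
syzygies φ w; injectivity turns the w into a Koszul cycle, hence a boundary, and correcting u 0
accordingly makes it divisible by `X 0`. -/
theorem mem_range_of_injective {φ : (ι → P) →ₗ[P] (κ → P)}
    {ψ : (κ → P) →ₗ[P] P} (hinj : Function.Injective φ)
    (hex : LinearMap.range φ = LinearMap.ker ψ) (e : P)
    (he : ∀ i : Fin 4, X i * e ∈ LinearMap.range ψ) : e ∈ LinearMap.range ψ := by
  choose u hu using he
  have hsyz : ∀ i j : Fin 4, ∃ w, φ w = (X j : P) • u i - (X i : P) • u j := fun i j => by
    have : (X j : P) • u i - (X i : P) • u j ∈ LinearMap.ker ψ := by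
      rw [LinearMap.mem_ker, map_sub, map_smul, map_smul, hu, hu, smul_eq_mul, smul_eq_mul]
      ring
    rw [← hex] at this
    exact this
  obtain ⟨w₀₁, h₀₁⟩ := hsyz 0 1
  obtain ⟨w₀₂, h₀₂⟩ := hsyz 0 2
  obtain ⟨w₁₂, h₁₂⟩ := hsyz 1 2
  obtain ⟨-, q, r, -, -, rfl⟩ := exists_of_smul_add_add_eq_zero (a := w₁₂) (b := -w₀₂) (c := w₀₁)
    (hinj (by
      simp only [map_add, map_smul, map_neg, map_zero, h₀₁, h₀₂, h₁₂]
      module))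
  simp only [map_sub, map_smul, map_neg] at h₀₁
  obtain ⟨c, -, hc⟩ := exists_of_smul_add_eq_zero (a := u 1 - φ q) (b := -(u 0 + φ r))
    (by linear_combination (norm := module) h₀₁)
  refine ⟨c, mul_left_cancel₀ (X_ne_zero (R := k) (0 : Fin 4)) ?_⟩
  have hr : ψ (φ r) = 0 := by
    rw [← LinearMap.mem_ker, ← hex]
    exact ⟨r, rfl⟩
  rw [← hu, ← smul_eq_mul, ← map_smul, ← neg_inj.1 hc, map_add, hr, add_zero]

/-! ### Fourth differences from regular sequences -/

section Difference

/-- The iterated backward difference of order four. -/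
def fourthDiff (h : ℤ → ℤ) (n : ℤ) : ℤ :=
  h n - 4 * h (n - 1) + 6 * h (n - 2) - 4 * h (n - 3) + h (n - 4)

/-- Condition `h₃` says that x is injective modulo the submodules, so the intersection of S with the
image of K' is the image of S'. -/
theorem finrank_sup_map {V : Type*} [AddCommGroup V] [Module k V] {x : V →ₗ[k] V}
    (hx : Function.Injective x) {S S' K' : Submodule k V} [Module.Finite k S] [Module.Finite k K']
    (h₁ : S' ≤ K') (h₂ : S'.map x ≤ S) (h₃ : ∀ u ∈ K', x u ∈ S → u ∈ S') :
    Module.finrank k (S ⊔ K'.map x : Submodule k V) + Module.finrank k S' =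
      Module.finrank k S + Module.finrank k K' := by
  have h : S ⊓ K'.map x = S'.map x := by
    refine le_antisymm ?_ (le_inf h₂ (Submodule.map_mono h₁))
    rintro _ ⟨hu, u, hu', rfl⟩
    exact ⟨u, h₃ u hu' hu, rfl⟩
  have h4 := Submodule.finrank_sup_add_finrank_inf_eq S (K'.map x)
  rwa [h, (Submodule.equivMapOfInjective x hx S').finrank_eq.symm,
    (Submodule.equivMapOfInjective x hx K').finrank_eq.symm] at h4

variable [Finite ι]

theorem fourthDiff_finrank {K : Submodule P (ι → P)} (hK : IsVarRegular K) {a : ι → ℤ}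
    (hgr : ∀ n, ∀ u ∈ K, vcomp a n u ∈ K) {n : ℤ}
    (hgen : ∀ u ∈ K, u ∈ piece a n → ∃ v : Fin 4 → ι → P, (∀ i, v i ∈ K) ∧
      (∀ i, v i ∈ piece a (n - 1)) ∧ u = ∑ i, (X i : P) • v i) :
    fourthDiff (fun n => Module.finrank k (K.restrictScalars k ⊓ piece a n : Submodule k (ι → P)))
      n = 0 := by
  let Q : ℤ → Submodule k (ι → P) := fun n => K.restrictScalars k ⊓ piece a n
  let x : Fin 4 → (ι → P) →ₗ[k] (ι → P) := fun i =>
    (LinearMap.lsmul P (ι → P) (X i : P)).restrictScalars k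
  have hx : ∀ i u, x i u = (X i : P) • u := fun _ _ => rfl
  have hinj : ∀ i, Function.Injective (x i) := fun i u v h => X_smul_injective i h
  have hfin : ∀ n, Module.Finite k (Q n) := fun n => Submodule.finiteDimensional_inf_right _ _
  have hcQ : ∀ m, ∀ u ∈ K, vcomp a m u ∈ Q m := fun m u hu => ⟨hgr m u hu, vcomp_mem a m u⟩
  have hxQ : ∀ i m, (Q (m - 1)).map (x i) ≤ Q m := by
    rintro i m _ ⟨u, hu, rfl⟩
    have := X_smul_mem_piece i hu.2
    rw [sub_add_cancel] at this
    exact ⟨K.smul_mem _ hu.1, this⟩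
  have hxx : ∀ i j m, ((Q (m - 1 - 1)).map (x i)).map (x j) ≤ (Q (m - 1)).map (x i) := by
    rintro i j m _ ⟨_, ⟨u, hu, rfl⟩, rfl⟩
    exact ⟨x j u, hxQ j _ ⟨u, hu, rfl⟩, smul_comm (X i : P) (X j : P) u⟩
  -- In degree m, these are the parts of K generated by the first one, two, three and four
  -- variables.
  let S₁ : ℤ → Submodule k (ι → P) := fun m => (Q (m - 1)).map (x 0)
  let S₂ : ℤ → Submodule k (ι → P) := fun m => S₁ m ⊔ (Q (m - 1)).map (x 1)
  let S₃ : ℤ → Submodule k (ι → P) := fun m => S₂ m ⊔ (Q (m - 1)).map (x 2)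
  let S₄ : ℤ → Submodule k (ι → P) := fun m => S₃ m ⊔ (Q (m - 1)).map (x 3)
  have hS₁ : ∀ m, S₁ m ≤ Q m := fun m => hxQ 0 m
  have hS₂ : ∀ m, S₂ m ≤ Q m := fun m => sup_le (hS₁ m) (hxQ 1 m)
  have hS₃ : ∀ m, S₃ m ≤ Q m := fun m => sup_le (hS₂ m) (hxQ 2 m)
  have hxS₁ : ∀ j m, (S₁ (m - 1)).map (x j) ≤ S₁ m := fun j m => hxx 0 j m
  have hxS₂ : ∀ j m, (S₂ (m - 1)).map (x j) ≤ S₂ m := fun j m => by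
    rw [Submodule.map_sup]
    exact sup_le_sup (hxS₁ j m) (hxx 1 j m)
  have hxS₃ : ∀ j m, (S₃ (m - 1)).map (x j) ≤ S₃ m := fun j m => by
    rw [Submodule.map_sup]
    exact sup_le_sup (hxS₂ j m) (hxx 2 j m)
  have d₁ : ∀ m, Module.finrank k (S₁ m) = Module.finrank k (Q (m - 1)) := fun m =>
    (Submodule.equivMapOfInjective (x 0) (hinj 0) (Q (m - 1))).finrank_eq.symm
  have d₂ : ∀ m, Module.finrank k (S₂ m) + Module.finrank k (S₁ (m - 1)) =
      Module.finrank k (S₁ m) + Module.finrank k (Q (m - 1)) := fun m => by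
    refine finrank_sup_map (hinj 1) (hS₁ _) (hxS₁ 1 m) ?_
    rintro u hu ⟨v, hv, h⟩
    obtain ⟨b, hb, h1⟩ := hK.reg₁ u hu.1 v hv.1 h.symm
    -- Regularity yields a witness with no control of degree; its component of degree m - 2 also
    -- works.
    refine ⟨vcomp a (m - 1 - 1) b, hcQ _ _ hb, ?_⟩
    rw [hx, ← vcomp_X_smul, ← h1, vcomp_of_mem hu.2]
  have d₃ : ∀ m, Module.finrank k (S₃ m) + Module.finrank k (S₂ (m - 1)) =
      Module.finrank k (S₂ m) + Module.finrank k (Q (m - 1)) := fun m => by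
    refine finrank_sup_map (hinj 2) (hS₂ _) (hxS₂ 2 m) ?_
    intro u hu h
    obtain ⟨_, ⟨v, hv, rfl⟩, _, ⟨w, hw, rfl⟩, h⟩ := Submodule.mem_sup.1 h
    obtain ⟨b, hb, c, hc, h1⟩ := hK.reg₂ u hu.1 v hv.1 w hw.1 h.symm
    refine Submodule.mem_sup.2 ⟨_, ⟨vcomp a (m - 1 - 1) b, hcQ _ _ hb, rfl⟩,
      _, ⟨vcomp a (m - 1 - 1) c, hcQ _ _ hc, rfl⟩, ?_⟩
    rw [hx, hx, ← vcomp_X_smul, ← vcomp_X_smul, ← map_add, ← h1, vcomp_of_mem hu.2]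
  have d₄ : ∀ m, Module.finrank k (S₄ m) + Module.finrank k (S₃ (m - 1)) =
      Module.finrank k (S₃ m) + Module.finrank k (Q (m - 1)) := fun m => by
    refine finrank_sup_map (hinj 3) (hS₃ _) (hxS₃ 3 m) ?_
    intro u hu h
    obtain ⟨_, h, _, ⟨z, hz, rfl⟩, h'⟩ := Submodule.mem_sup.1 h
    obtain ⟨_, ⟨v, hv, rfl⟩, _, ⟨w, hw, rfl⟩, rfl⟩ := Submodule.mem_sup.1 h
    obtain ⟨b, hb, c, hc, e, he, h1⟩ := hK.reg₃ u hu.1 v hv.1 w hw.1 z hz.1 h'.symm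
    refine Submodule.mem_sup.2 ⟨_, Submodule.mem_sup.2 ⟨_, ⟨vcomp a (m - 1 - 1) b, hcQ _ _ hb, rfl⟩,
      _, ⟨vcomp a (m - 1 - 1) c, hcQ _ _ hc, rfl⟩, rfl⟩,
      _, ⟨vcomp a (m - 1 - 1) e, hcQ _ _ he, rfl⟩, ?_⟩
    rw [hx, hx, hx, ← vcomp_X_smul, ← vcomp_X_smul, ← vcomp_X_smul, ← map_add, ← map_add, ← h1,
      vcomp_of_mem hu.2]
  -- In degree n there are no new generators, so K is exhausted by multiples of the variables.
  have hS₄ : S₄ n = Q n := by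
    refine le_antisymm (sup_le (hS₃ n) (hxQ 3 n)) ?_
    intro u hu
    obtain ⟨v, hvK, hv, rfl⟩ := hgen u hu.1 hu.2
    rw [Fin.sum_univ_four]
    exact Submodule.add_mem_sup (Submodule.add_mem_sup (Submodule.add_mem_sup
      ⟨v 0, ⟨hvK 0, hv 0⟩, rfl⟩ ⟨v 1, ⟨hvK 1, hv 1⟩, rfl⟩) ⟨v 2, ⟨hvK 2, hv 2⟩, rfl⟩)
      ⟨v 3, ⟨hvK 3, hv 3⟩, rfl⟩
  have e₄ := d₄ n
  have e₃ := d₃ n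
  have e₃' := d₃ (n - 1)
  have e₂ := d₂ n
  have e₂' := d₂ (n - 1)
  have e₂'' := d₂ (n - 1 - 1)
  rw [hS₄] at e₄
  simp only [d₁] at e₄ e₃ e₃' e₂ e₂' e₂''
  have h2 : n - 2 = n - 1 - 1 := by ring
  have h3 : n - 3 = n - 1 - 1 - 1 := by ring
  have h4 : n - 4 = n - 1 - 1 - 1 - 1 := by ring
  change (Module.finrank k (Q n) : ℤ) - 4 * Module.finrank k (Q (n - 1)) +
    6 * Module.finrank k (Q (n - 2)) - 4 * Module.finrank k (Q (n - 3)) +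
    Module.finrank k (Q (n - 4)) = 0
  rw [h2, h3, h4]
  omega

end Difference

end Vectors
-- Hilbert functions of regular saturated ideals
section Hilbert

variable {k : Type*} [Field k]

local notation "P" => MvPolynomial (Fin 4) k

/-- The forms of degree `n` in the ideal `I`. -/
noncomputable def idealPiece (I : Ideal P) (n : ℤ) : Submodule k P :=
  I.restrictScalars k ⊓ forms (Fin 4) k n

instance finite_idealPiece (I : Ideal P) (n : ℤ) : Module.Finite k (idealPiece I n) :=
  Submodule.finiteDimensional_inf_right _ _

theorem idealPiece_mono {I J : Ideal P} (h : I ≤ J) (n : ℤ) : idealPiece I n ≤ idealPiece J n :=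
  fun _ hf => ⟨h hf.1, hf.2⟩

theorem hilbertFunction_add_finrank (I : Ideal P) (n : ℕ) :
    hilbertFunction I n + Module.finrank k (idealPiece I n) =
      Module.finrank k (forms (Fin 4) k n) := by
  have h := LinearMap.finrank_range_add_finrank_ker
    ((Ideal.Quotient.mkₐ k I).toLinearMap.domRestrict (forms (Fin 4) k n))
  rw [LinearMap.range_domRestrict, LinearMap.ker_domRestrict] at h
  have hk : LinearMap.ker (Ideal.Quotient.mkₐ k I).toLinearMap = I.restrictScalars k := by
    ext f
    simp [Ideal.Quotient.eq_zero_iff_mem]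
  rw [← h, hilbertFunction, forms_natCast, ← Submodule.finrank_map_subtype_eq,
    Submodule.map_comap_subtype, idealPiece, inf_comm, forms_natCast, hk]

/-- Each summand is a cubic polynomial at the five points involved: n - 4 - a j is at least -3. -/
theorem fourthDiff_finrank_piece {ι : Type*} [Fintype ι] {a : ι → ℤ} {n : ℤ} (h : ∀ j, a j < n) :
    fourthDiff (fun n => Module.finrank k (piece (σ := Fin 4) (k := k) a n)) n = 0 := by
  simp only [fourthDiff, finrank_piece, Nat.cast_sum, Finset.mul_sum, ← Finset.sum_sub_distrib,
    ← Finset.sum_add_distrib]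
  refine Finset.sum_eq_zero fun j _ => ?_
  have hj := h j
  have h0 := six_mul_finrank_forms (k := k) (n := n - a j) (by omega)
  have h1 := six_mul_finrank_forms (k := k) (n := n - 1 - a j) (by omega)
  have h2 := six_mul_finrank_forms (k := k) (n := n - 2 - a j) (by omega)
  have h3 := six_mul_finrank_forms (k := k) (n := n - 3 - a j) (by omega)
  have h4 := six_mul_finrank_forms (k := k) (n := n - 4 - a j) (by omega)
  refine mul_left_cancel₀ (show (6 : ℤ) ≠ 0 by norm_num) ?_
  linear_combination h0 - 4 * h1 + 6 * h2 - 4 * h3 + h4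

theorem finrank_piece_eq_ker_add_idealPiece {ι : Type*} [Finite ι] [DecidableEq ι] {I : Ideal P}
    {a : ι → ℤ} {φ : (ι → P) →ₗ[P] P} (hφ : ∀ j, φ (Pi.single j 1) ∈ forms (Fin 4) k (a j))
    (hI : LinearMap.range φ = I) (n : ℤ) :
    Module.finrank k (piece (σ := Fin 4) (k := k) a n) =
      Module.finrank k ((LinearMap.ker φ).restrictScalars k ⊓ piece a n : Submodule k (ι → P)) +
        Module.finrank k (idealPiece I n) := by
  have := Fintype.ofFinite ι
  have hc : ∀ m u, comp m (φ u) = φ (vcomp a m u) := fun m u => by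
    simpa using comp_apply_of_forms (b := 0) (by simpa using hφ) m u
  have := finrank_eq_of_commute (φ := φ.restrictScalars k) (π := vcomp a n) (ρ := comp n)
    (A := piece a n) (B := forms (Fin 4) k n) (vcomp_mem a n)
    (fun v hv => by
      change φ v ∈ _
      rw [← vcomp_of_mem hv, ← hc]
      exact comp_mem _ _)
    (fun w hw => comp_of_mem hw) (hc n)
  rw [this, idealPiece, ← hI]
  rfl

theorem finrank_piece_eq_ker_add_ker {ι κ : Type*} [Finite ι] [DecidableEq ι]
    {a : ι → ℤ} {b : κ → ℤ} {φ : (ι → P) →ₗ[P] (κ → P)} {ψ : (κ → P) →ₗ[P] P}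
    (hφ : ∀ j l, φ (Pi.single j 1) l ∈ forms (Fin 4) k (a j - b l))
    (hex : LinearMap.range φ = LinearMap.ker ψ) (n : ℤ) :
    Module.finrank k (piece (σ := Fin 4) (k := k) a n) =
      Module.finrank k ((LinearMap.ker φ).restrictScalars k ⊓ piece a n : Submodule k (ι → P)) +
      Module.finrank k ((LinearMap.ker ψ).restrictScalars k ⊓ piece b n :
        Submodule k (κ → P)) := by
  have := Fintype.ofFinite ι
  have hc := vcomp_apply_of_forms hφ
  have := finrank_eq_of_commute (φ := φ.restrictScalars k) (π := vcomp a n) (ρ := vcomp b n)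
    (A := piece a n) (B := piece b n) (vcomp_mem a n)
    (fun v hv => by
      change φ v ∈ _
      rw [← vcomp_of_mem hv, ← hc]
      exact vcomp_mem _ _ _)
    (fun w hw => vcomp_of_mem hw) (hc n)
  rw [this, ← hex]
  rfl

theorem exists_mem_range_eq_sum {ι κ : Type*} [Fintype ι] [DecidableEq ι]
    {a : ι → ℤ} {b : κ → ℤ} {φ : (ι → P) →ₗ[P] (κ → P)}
    (hφ : ∀ j l, φ (Pi.single j 1) l ∈ forms (Fin 4) k (a j - b l))
    {n : ℤ} (hn : ∀ j, a j < n) {u : κ → P} (hu : u ∈ LinearMap.range φ)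
    (hun : u ∈ piece b n) : ∃ v : Fin 4 → κ → P, (∀ i, v i ∈ LinearMap.range φ) ∧
      (∀ i, v i ∈ piece b (n - 1)) ∧ u = ∑ i, (X i : P) • v i := by
  obtain ⟨w, rfl⟩ := hu
  obtain ⟨v, hv, hw⟩ := exists_eq_sum_X_smul hn (vcomp_mem a n w)
  refine ⟨fun i => φ (v i), fun i => ⟨_, rfl⟩, fun i => ?_, ?_⟩
  · change φ (v i) ∈ _
    rw [← vcomp_of_mem (hv i), ← vcomp_apply_of_forms hφ]
    exact vcomp_mem _ _ _
  · rw [← vcomp_of_mem hun, vcomp_apply_of_forms hφ, hw, map_sum]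
    simp

theorem exists_mem_idealPiece_eq_sum {ι : Type*} [Fintype ι] [DecidableEq ι]
    {I : Ideal P} {a : ι → ℤ} {φ : (ι → P) →ₗ[P] P}
    (hφ : ∀ j, φ (Pi.single j 1) ∈ forms (Fin 4) k (a j)) (hI : LinearMap.range φ = I)
    {n : ℤ} (hn : ∀ j, a j < n) {f : P} (hf : f ∈ idealPiece I n) :
    ∃ g : Fin 4 → P, (∀ i, g i ∈ idealPiece I (n - 1)) ∧ f = ∑ i, X i * g i := by
  obtain ⟨v, hv, hv', h⟩ := exists_mem_range_eq_sum (b := fun _ : Unit => (0 : ℤ))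
    (φ := LinearMap.pi fun _ => φ) (fun j _ => by simpa using hφ j) hn (u := fun _ => f)
    (by
      obtain ⟨w, hw⟩ := hI.symm ▸ hf.1
      exact ⟨w, _root_.funext fun _ => hw⟩)
    (mem_piece.2 fun _ => by simpa using hf.2)
  refine ⟨fun i => v i (), fun i => ⟨?_, by simpa using mem_piece.1 (hv' i) ()⟩, ?_⟩
  · obtain ⟨w, hw⟩ := hv i
    change v i () ∈ I
    rw [← hw, ← hI]
    exact ⟨w, rfl⟩
  · simpa using congrFun h ()

theorem IsSaturated.mem_of_X_mul_mem {I : Ideal P} (hI : IsSaturated I) {e : P}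
    (he : ∀ i, X i * e ∈ I) : e ∈ I := by
  refine hI e 1 fun g hg => ?_
  rw [pow_one] at hg
  have : idealOfVars (Fin 4) k ≤ Submodule.comap (LinearMap.mulRight P e) I := by
    refine Ideal.span_le.2 ?_
    rintro _ ⟨i, rfl⟩
    exact he i
  exact this hg

theorem isSaturated_of_X_mul_mem {I : Ideal P} (hI : ∀ e : P, (∀ i, X i * e ∈ I) → e ∈ I) :
    IsSaturated I := by
  intro h N
  induction N with
  | zero => exact fun H => by simpa using H 1 (by simp)
  | succ N ih =>
    intro H
    refine ih fun g hg => hI _ fun i => ?_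
    rw [← mul_assoc]
    refine H _ ?_
    rw [pow_succ']
    exact Ideal.mul_mem_mul (Ideal.subset_span ⟨i, rfl⟩) hg

/-- The Hilbert function of a saturated `m`-regular ideal is polynomial from `m - 1` on. -/
theorem fourthDiff_finrank_idealPiece {I : Ideal P} (hI : IsSaturated I) {m : ℤ}
    (hm : IsRegular I m) {n : ℤ} (hn : m + 2 < n) :
    fourthDiff (fun n => Module.finrank k (idealPiece I n)) n = 0 := by
  obtain ⟨R, hR⟩ := hm
  have hd : ∀ i j l, R.d i (Pi.single j 1) l ∈ forms (Fin 4) k (R.deg (i + 1) j - R.deg i l) :=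
    fun i j l => mem_forms.2 (R.isForm_d i j l)
  have hdeg : ∀ i : ℕ, i ≤ 2 → ∀ j, R.deg i j < n := fun i hi j => by
    have := hR i j
    omega
  -- The tail of the resolution beyond F₁ enters only through this kernel, whose generators come
  -- from F₂, in degrees at most m + 2.
  have hK : IsVarRegular (LinearMap.ker (R.d 0)) := isVarRegular_ker R.exact_zero (by
    rw [R.range_aug]
    exact fun e => hI.mem_of_X_mul_mem)
  have e₀ := finrank_piece_eq_ker_add_idealPiece (fun j => mem_forms.2 (R.isForm_aug j)) R.range_aug
  have e₁ := finrank_piece_eq_ker_add_ker (hd 0) R.exact_zero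
  have d₀ := fourthDiff_finrank_piece (k := k) (hdeg 0 (by omega))
  have d₁ := fourthDiff_finrank_piece (k := k) (hdeg 1 (by omega))
  have d₂ := fourthDiff_finrank hK (a := R.deg 1) (n := n)
    (fun n u hu => by
      rw [LinearMap.mem_ker] at hu ⊢
      rw [← vcomp_apply_of_forms (hd 0), hu, map_zero])
    (fun u hu hun => by
      rw [← R.exact_succ 0] at hu ⊢
      exact exists_mem_range_eq_sum (hd 1) (hdeg 2 le_rfl) hu hun)
  simp only [fourthDiff, e₀, e₁, Nat.cast_add] at d₀ d₁ d₂ ⊢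
  linear_combination d₀ - d₁ + d₂

end Hilbert

/-! ### Consequences of a resolution of length one -/

section ShortResolution

variable {k : Type*} [Field k]

/-- A graded free resolution of length one of an ideal, with generators of degrees `a` and
relations of degrees `b`. -/
structure ShortResolution (I : Ideal (MvPolynomial (Fin 4) k)) {r s : ℕ}
    (a : Fin r → ℤ) (b : Fin s → ℤ) where
  gen : Fin r → MvPolynomial (Fin 4) k
  rel : Fin s → Fin r → MvPolynomial (Fin 4) k
  gen_mem : ∀ j, gen j ∈ forms (Fin 4) k (a j)
  rel_mem : ∀ j l, rel j l ∈ forms (Fin 4) k (b j - a l)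
  span_gen : Ideal.span (Set.range gen) = I
  sum_rel : ∀ j, ∑ l, rel j l * gen l = 0
  exists_of_sum : ∀ u : Fin r → MvPolynomial (Fin 4) k, ∑ l, u l * gen l = 0 →
    ∃ v : Fin s → MvPolynomial (Fin 4) k, u = ∑ j, v j • rel j
  linearIndependent : LinearIndependent (MvPolynomial (Fin 4) k) rel

namespace ShortResolution

variable {I : Ideal (MvPolynomial (Fin 4) k)} {r s : ℕ} {a : Fin r → ℤ} {b : Fin s → ℤ}

theorem range_gen (R : ShortResolution I a b) :
    LinearMap.range (Fintype.linearCombination (MvPolynomial (Fin 4) k) R.gen) = I := by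
  rw [Fintype.range_linearCombination]
  exact R.span_gen

theorem injective_rel (R : ShortResolution I a b) :
    Function.Injective (Fintype.linearCombination (MvPolynomial (Fin 4) k) R.rel) :=
  R.linearIndependent.fintypeLinearCombination_injective

theorem range_rel (R : ShortResolution I a b) :
    LinearMap.range (Fintype.linearCombination (MvPolynomial (Fin 4) k) R.rel) =
      LinearMap.ker (Fintype.linearCombination (MvPolynomial (Fin 4) k) R.gen) := by
  refine le_antisymm ?_ fun u hu => ?_
  · rw [Fintype.range_linearCombination, Submodule.span_le]
    rintro _ ⟨j, rfl⟩
    simpa [Fintype.linearCombination_apply] using R.sum_rel j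
  · obtain ⟨v, rfl⟩ := R.exists_of_sum u (by
      simpa [Fintype.linearCombination_apply] using hu)
    exact ⟨v, rfl⟩

theorem gen_single (R : ShortResolution I a b) (j : Fin r) :
    Fintype.linearCombination (MvPolynomial (Fin 4) k) R.gen (Pi.single j 1) = R.gen j := by
  rw [Fintype.linearCombination_apply_single, one_smul]

theorem rel_single (R : ShortResolution I a b) (j : Fin s) :
    Fintype.linearCombination (MvPolynomial (Fin 4) k) R.rel (Pi.single j 1) = R.rel j := by
  rw [Fintype.linearCombination_apply_single, one_smul]

theorem isSaturated (R : ShortResolution I a b) : IsSaturated I :=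
  isSaturated_of_X_mul_mem fun e he =>
    R.range_gen ▸ mem_range_of_injective R.injective_rel R.range_rel e (by rwa [R.range_gen])

theorem sum_finrank (R : ShortResolution I a b) (n : ℤ) :
    ∑ j, Module.finrank k (forms (Fin 4) k (n - a j)) =
      ∑ j, Module.finrank k (forms (Fin 4) k (n - b j)) + Module.finrank k (idealPiece I n) := by
  have h1 := finrank_piece_eq_ker_add_idealPiece
    (fun j => by rw [R.gen_single]; exact R.gen_mem j) R.range_gen n
  have h2 := finrank_piece_eq_ker_add_ker (a := b) (b := a)
    (fun j l => by rw [R.rel_single]; exact R.rel_mem j l) R.range_rel n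
  have h3 : (LinearMap.ker (Fintype.linearCombination (MvPolynomial (Fin 4) k) R.rel)).restrictScalars k ⊓
      piece b n =
      ⊥ := by
    rw [LinearMap.ker_eq_bot.2 R.injective_rel]
    simp
  rw [h3, finrank_bot, zero_add, finrank_piece] at h2
  rw [finrank_piece, ← h2] at h1
  exact h1

theorem isHomogeneous (R : ShortResolution I a b) :
    I.IsHomogeneous (homogeneousSubmodule (Fin 4) k) := by
  refine R.span_gen ▸ Ideal.homogeneous_span _ _ ?_
  rintro _ ⟨j, rfl⟩
  rcases mem_forms.1 (R.gen_mem j) with h | ⟨m, -, h⟩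
  · exact ⟨0, by rw [h]; exact zero_mem _⟩
  · exact ⟨m, h⟩

theorem isRegular (R : ShortResolution I a b) {m : ℤ} (ha : ∀ j, a j ≤ m) (hb : ∀ j, b j ≤ m + 1) :
    IsRegular I m := by
  let rank : ℕ → ℕ := fun i => match i with
    | 0 => r
    | 1 => s
    | _ => 0
  refine ⟨{
    rank := rank
    deg := fun i => match i with
      | 0 => a
      | 1 => b
      | _ + 2 => Fin.elim0
    aug := Fintype.linearCombination (MvPolynomial (Fin 4) k) R.gen
    d := fun i => match i with
      | 0 => Fintype.linearCombination (MvPolynomial (Fin 4) k) R.rel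
      | _ + 1 => 0
    isForm_aug := fun j => by
      have := R.gen_single j
      exact this ▸ mem_forms.1 (R.gen_mem j)
    isForm_d := fun i => match i with
      | 0 => fun j l => by
        have := R.rel_single j
        exact this ▸ mem_forms.1 (R.rel_mem j l)
      | i + 1 => fun j => Fin.elim0 j
    range_aug := R.range_gen
    exact_zero := R.range_rel
    exact_succ := fun i => match i with
      | 0 => by
        change LinearMap.range 0 =
          LinearMap.ker (Fintype.linearCombination (MvPolynomial (Fin 4) k) R.rel)
        rw [LinearMap.ker_eq_bot.2 R.injective_rel, LinearMap.range_zero]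
      | i + 1 => by
        refine le_antisymm ?_ fun u _ => ?_
        · rintro _ ⟨u, rfl⟩
          rfl
        · rw [show u = 0 from _root_.funext fun j => Fin.elim0 j]
          exact zero_mem _ }, fun i => ?_⟩
  match i with
  | 0 => exact fun j => by simpa using ha j
  | 1 => exact fun j => by simpa using hb j
  | i + 2 => exact fun j => Fin.elim0 j

end ShortResolution

end ShortResolution
-- Divisibility of forms
section Divisibility

variable {σ k : Type*} [Field k]

theorem exists_mem_forms_of_dvd {m n : ℤ} {f g : MvPolynomial σ k} (hf : f ∈ forms σ k m)
    (hg : g ∈ forms σ k n) (h : f ∣ g) : ∃ q ∈ forms σ k (n - m), g = f * q := by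
  obtain ⟨q, rfl⟩ := h
  refine ⟨comp (n - m) q, comp_mem _ _, ?_⟩
  rw [← comp_mul hf, sub_add_cancel, comp_of_mem hg]

theorem eq_zero_of_dvd_of_lt {m n : ℤ} {f g : MvPolynomial σ k} (hf : f ∈ forms σ k m)
    (hg : g ∈ forms σ k n) (h : f ∣ g) (hmn : n < m) : g = 0 := by
  obtain ⟨q, hq, rfl⟩ := exists_mem_forms_of_dvd hf hg h
  rw [forms_of_neg (by omega), Submodule.mem_bot] at hq
  rw [hq, mul_zero]

theorem exists_eq_C_of_mem_forms_zero {f : MvPolynomial σ k} (hf : f ∈ forms σ k 0) :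
    ∃ c, f = C c :=
  ⟨_, totalDegree_eq_zero_iff_eq_C.1
    ((totalDegree_zero_iff_isHomogeneous _).2 (mem_forms_natCast (n := 0).1 hf))⟩

theorem isUnit_of_totalDegree_eq_zero {f : MvPolynomial σ k} (hf : f ≠ 0)
    (h : f.totalDegree = 0) : IsUnit f := by
  rw [totalDegree_eq_zero_iff_eq_C] at h
  rw [h] at hf ⊢
  exact (isUnit_iff_ne_zero.2 fun h0 => hf (by rw [h0, C_0])).map C

theorem not_isUnit_of_mem_forms {n : ℤ} (hn : 0 < n) {f : MvPolynomial σ k}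
    (hf : f ∈ forms σ k n) : ¬ IsUnit f := fun h =>
  one_ne_zero (eq_zero_of_dvd_of_lt hf (mem_forms_natCast (n := 0).2 (isHomogeneous_one σ k))
    h.dvd (by simpa using hn))

theorem totalDegree_of_mem_forms {n : ℕ} {f : MvPolynomial σ k} (hf : f ∈ forms σ k n)
    (h0 : f ≠ 0) : f.totalDegree = n :=
  (mem_forms_natCast.1 hf).totalDegree h0

theorem prime_of_mem_forms_one {l : MvPolynomial σ k} (hl : l ∈ forms σ k 1) (h0 : l ≠ 0) :
    Prime l := by
  refine Irreducible.prime ⟨not_isUnit_of_mem_forms one_pos hl, ?_⟩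
  rintro a b rfl
  have h1 := totalDegree_of_mem_forms (n := 1) hl h0
  have ha := left_ne_zero_of_mul h0
  have hb := right_ne_zero_of_mul h0
  rw [totalDegree_mul_of_isDomain ha hb] at h1
  rcases Nat.eq_zero_or_pos a.totalDegree with h | h
  · exact Or.inl (isUnit_of_totalDegree_eq_zero ha h)
  · exact Or.inr (isUnit_of_totalDegree_eq_zero hb (by omega))

/-- A divisor of full degree leaves only constant cofactors, so both forms are scalar multiples of
d. -/
theorem not_linearIndependent_of_dvd {n : ℕ} {d u q : MvPolynomial σ k}
    (hp : d * u ∈ forms σ k n) (hq : q ∈ forms σ k n) (hd : d.totalDegree = n)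
    (hdq : d ∣ q) : ¬ LinearIndependent k ![d * u, q] := by
  intro h
  obtain ⟨v, rfl⟩ := hdq
  have h₁ : d * u ≠ 0 := h.ne_zero 0
  have h₂ : d * v ≠ 0 := h.ne_zero 1
  have hC : ∀ w, d * w ∈ forms σ k n → d * w ≠ 0 → ∃ a, w = C a := fun w hw h0 => by
    have h1 := totalDegree_of_mem_forms hw h0
    rw [totalDegree_mul_of_isDomain (left_ne_zero_of_mul h0) (right_ne_zero_of_mul h0)] at h1
    exact ⟨_, totalDegree_eq_zero_iff_eq_C.1 (by omega)⟩
  obtain ⟨a, rfl⟩ := hC u hp h₁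
  obtain ⟨b, rfl⟩ := hC v hq h₂
  have h3 := (LinearIndependent.pair_iff.1 h b (-a) (by
    rw [smul_eq_C_mul, smul_eq_C_mul, C_neg]
    ring)).2
  rw [neg_eq_zero] at h3
  rw [h3, C_0, mul_zero] at h₁
  exact h₁ rfl

theorem isRelPrime_of_linearIndependent {p q : MvPolynomial σ k} (hp : p ∈ forms σ k 1)
    (hq : q ∈ forms σ k 1) (h : LinearIndependent k ![p, q]) : IsRelPrime p q := by
  have hp0 : p ≠ 0 := h.ne_zero 0
  rintro d ⟨u, rfl⟩ hdq
  have h1 := totalDegree_of_mem_forms (n := 1) hp hp0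
  have hd := left_ne_zero_of_mul hp0
  rw [totalDegree_mul_of_isDomain hd (right_ne_zero_of_mul hp0)] at h1
  refine isUnit_of_totalDegree_eq_zero hd ?_
  by_contra h2
  exact not_linearIndependent_of_dvd (n := 1) hp hq (by omega) hdq h

theorem comp_two_mul_of_totalDegree {d u : MvPolynomial σ k} (hd : d.totalDegree = 1)
    (hu : u.totalDegree = 1) : comp 2 (d * u) = comp 1 d * comp 1 u := by
  have h : d = comp 0 d + comp 1 d := by
    conv_lhs => rw [← sum_homogeneousComponent d, hd]
    simp [Finset.sum_range_succ, comp]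
  have h2 : comp 2 u = 0 := by
    simpa [comp] using homogeneousComponent_eq_zero 2 u (by omega)
  conv_lhs => rw [h, add_mul, map_add]
  have e0 := comp_mul (comp_mem 0 d) 2 u
  have e1 := comp_mul (comp_mem 1 d) 1 u
  norm_num at e0 e1
  rw [e0, e1, h2, mul_zero, zero_add]

/-- A nonunit common divisor has degree 1, since degree 2 would make p and q proportional. It is not
known to be homogeneous, so it and the cofactors are replaced by their components of degree 1. -/
theorem exists_common_factor {p q : MvPolynomial σ k} (hp : p ∈ forms σ k 2)
    (hq : q ∈ forms σ k 2) (h : LinearIndependent k ![p, q]) (hpq : ¬ IsRelPrime p q) :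
    ∃ l ∈ forms σ k 1, ∃ l₁ ∈ forms σ k 1, ∃ l₂ ∈ forms σ k 1, p = l * l₁ ∧ q = l * l₂ := by
  simp only [IsRelPrime, not_forall] at hpq
  obtain ⟨d, hdp, hdq, hd⟩ := hpq
  obtain ⟨u, rfl⟩ := hdp
  have hp0 : d * u ≠ 0 := h.ne_zero 0
  have hq0 : q ≠ 0 := h.ne_zero 1
  have hd0 := left_ne_zero_of_mul hp0
  have h1 := totalDegree_of_mem_forms (n := 2) hp hp0
  rw [totalDegree_mul_of_isDomain hd0 (right_ne_zero_of_mul hp0)] at h1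
  have h3 : d.totalDegree ≠ 0 := fun h => hd (isUnit_of_totalDegree_eq_zero hd0 h)
  have h4 : d.totalDegree ≠ 2 := fun h5 => not_linearIndependent_of_dvd (n := 2) hp hq h5 hdq h
  obtain ⟨v, rfl⟩ := hdq
  have h2 := totalDegree_of_mem_forms (n := 2) hq hq0
  rw [totalDegree_mul_of_isDomain hd0 (right_ne_zero_of_mul hq0)] at h2
  refine ⟨comp 1 d, comp_mem _ _, comp 1 u, comp_mem _ _, comp 1 v, comp_mem _ _, ?_, ?_⟩
  · rw [← comp_two_mul_of_totalDegree (by omega) (by omega), comp_of_mem hp]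
  · rw [← comp_two_mul_of_totalDegree (by omega) (by omega), comp_of_mem hq]

theorem _root_.IsRelPrime.exists_of_mul_add_mul_eq_zero {R : Type*} [CommRing R] [IsDomain R]
    [DecompositionMonoid R] {p q x y : R} (h : IsRelPrime p q) (hp : p ≠ 0)
    (hxy : x * p + y * q = 0) : ∃ c, x = c * q ∧ y = -(c * p) := by
  obtain ⟨c, rfl⟩ : p ∣ y := h.dvd_of_dvd_mul_right ⟨-x, by linear_combination hxy⟩
  exact ⟨-c, mul_right_cancel₀ hp (by linear_combination hxy), by ring⟩

end Divisibility

/-! ### Koszul and Hilbert–Burch resolutions -/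

section Resolutions

variable {k : Type*} [Field k]

/-- The resolution of the ideal generated by the multiples `c * p`, `c * q` of two coprime
forms. -/
noncomputable def pairResolution {d e : ℤ} {c p q : MvPolynomial (Fin 4) k}
    (hc : c ∈ forms (Fin 4) k e)
    (hp : p ∈ forms (Fin 4) k d) (hq : q ∈ forms (Fin 4) k d) (hc0 : c ≠ 0) (hp0 : p ≠ 0)
    (h : IsRelPrime p q) :
    ShortResolution (Ideal.span {c * p, c * q}) ![e + d, e + d] ![e + 2 * d] where
  gen := ![c * p, c * q]
  rel := ![![q, -p]]
  gen_mem j := by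
    fin_cases j
    · exact mul_mem_forms hc hp
    · exact mul_mem_forms hc hq
  rel_mem j l := by
    have h1 : e + 2 * d - (e + d) = d := by ring
    fin_cases j
    fin_cases l
    · simpa [h1] using hq
    · simpa [h1] using hp
  span_gen := by simp [Set.pair_comm]
  sum_rel j := by
    fin_cases j
    simp
    ring
  exists_of_sum u hu := by
    rw [Fin.sum_univ_two] at hu
    obtain ⟨t, h0, h1⟩ := h.exists_of_mul_add_mul_eq_zero hp0 (x := u 0) (y := u 1)
      (mul_left_cancel₀ hc0 (by
        simp only [Matrix.cons_val_zero, Matrix.cons_val_one] at hu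
        linear_combination hu))
    refine ⟨fun _ => t, _root_.funext fun j => ?_⟩
    fin_cases j
    · simpa using h0
    · simpa using h1
  linearIndependent := by
    rw [linearIndependent_unique_iff]
    intro h
    exact hp0 (by simpa using congrFun h 1)

/-- The Hilbert-Burch resolution of the ideal of a plane cubic and a line, with multiplicities. -/
noncomputable def cubicResolution {l l₁ l₂ A B : MvPolynomial (Fin 4) k}
    (hl : l ∈ forms (Fin 4) k 1) (hl₁ : l₁ ∈ forms (Fin 4) k 1) (hl₂ : l₂ ∈ forms (Fin 4) k 1)
    (hA : A ∈ forms (Fin 4) k 2) (hB : B ∈ forms (Fin 4) k 2) (hl0 : l ≠ 0)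
    (h : LinearIndependent k ![l₁, l₂]) (hf : ¬ l ∣ A * l₁ + B * l₂) :
    ShortResolution (Ideal.span {l * l₁, l * l₂, A * l₁ + B * l₂}) ![2, 2, 3] ![3, 4] where
  gen := ![l * l₁, l * l₂, A * l₁ + B * l₂]
  rel := ![![l₂, -l₁, 0], ![A, B, -l]]
  gen_mem j := by
    fin_cases j
    · exact mul_mem_forms hl hl₁
    · exact mul_mem_forms hl hl₂
    · exact add_mem (mul_mem_forms hA hl₁) (mul_mem_forms hB hl₂)
  rel_mem j l := by
    fin_cases j <;> fin_cases l <;> simp <;> assumption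
  span_gen := by
    congr 1
    ext x
    simp
    tauto
  sum_rel j := by
    fin_cases j <;> simp [Fin.sum_univ_three] <;> ring
  exists_of_sum u hu := by
    simp only [Fin.sum_univ_three, Matrix.cons_val_zero, Matrix.cons_val_one,
      Matrix.cons_val] at hu
    -- The prime l divides u 2 times the cubic but not the cubic. Adding w times the second relation
    -- then leaves a syzygy of l₁ and l₂.
    obtain ⟨w, hw⟩ : l ∣ u 2 := ((prime_of_mem_forms_one hl hl0).dvd_or_dvd
      ⟨-(u 0 * l₁) - u 1 * l₂, by linear_combination hu⟩).resolve_right hf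
    obtain ⟨t, h0, h1⟩ := (isRelPrime_of_linearIndependent hl₁ hl₂ h).exists_of_mul_add_mul_eq_zero
      (h.ne_zero 0) (x := u 0 + w * A) (y := u 1 + w * B) (mul_left_cancel₀ hl0 (by
        rw [hw] at hu
        linear_combination hu))
    refine ⟨![t, -w], _root_.funext fun j => ?_⟩
    fin_cases j <;> simp
    · linear_combination h0
    · linear_combination h1
    · linear_combination hw
  linearIndependent := by
    rw [LinearIndependent.pair_iff]
    intro s t hst
    have h2 := congrFun hst 2
    have h0 := congrFun hst 0
    have hl₂0 : l₂ ≠ 0 := h.ne_zero 1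
    have ht : t = 0 := by simpa [hl0] using h2
    subst ht
    exact ⟨by simpa [hl₂0] using h0, rfl⟩

end Resolutions
-- Hilbert polynomial and generation in low degrees
section HilbertPolynomial

variable {k : Type*} [Field k] {I J : Ideal (MvPolynomial (Fin 4) k)}

theorem hasHilbertPolynomial_iff : HasHilbertPolynomial I (Polynomial.C 4 * Polynomial.X) ↔
    ∀ᶠ n : ℕ in atTop, (Module.finrank k (idealPiece I n) : ℤ) =
      Module.finrank k (forms (Fin 4) k n) - 4 * n := by
  unfold HasHilbertPolynomial
  refine eventually_congr (Eventually.of_forall fun n => ?_)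
  have h := hilbertFunction_add_finrank I n
  rw [← h]
  simp only [Polynomial.eval_mul, Polynomial.eval_C, Polynomial.eval_X]
  rw [Nat.cast_add, eq_sub_iff_add_eq, add_comm, add_right_cancel_iff, eq_comm]
  exact_mod_cast Iff.rfl

/-- The Hilbert function of a saturated 3-regular ideal with Hilbert polynomial `4 n`. -/
theorem finrank_idealPiece_of_isRegular_three (hI : IsSaturated I) (hreg : IsRegular I 3)
    (hp : HasHilbertPolynomial I (Polynomial.C 4 * Polynomial.X)) {n : ℤ} (hn : 2 ≤ n) :
    (Module.finrank k (idealPiece I n) : ℤ) = Module.finrank k (forms (Fin 4) k n) - 4 * n := by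
  obtain ⟨N, hN⟩ := eventually_atTop.1 (hasHilbertPolynomial_iff.1 hp)
  -- Downward induction from N: the vanishing fourth difference at m + 4 is solved for its lowest
  -- term, and m ≥ 2 is exactly what puts m + 4 beyond 5.
  have key : ∀ j : ℕ, ∀ m : ℤ, 2 ≤ m → (N : ℤ) ≤ m + j →
      6 * (Module.finrank k (idealPiece I m) : ℤ) = (m + 3) * (m + 2) * (m + 1) - 24 * m := by
    intro j
    induction j with
    | zero =>
      intro m hm hNm
      lift m to ℕ using by omega
      have h1 := hN m (by omega)
      have h2 := six_mul_finrank_forms (k := k) (n := m) (by omega)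
      linear_combination 6 * h1 + h2
    | succ j ih =>
      intro m hm hNm
      have d := fourthDiff_finrank_idealPiece hI hreg (n := m + 4) (by omega)
      have h1 := ih (m + 4) (by omega) (by push_cast at hNm; omega)
      have h2 := ih (m + 4 - 1) (by omega) (by push_cast at hNm; omega)
      have h3 := ih (m + 4 - 2) (by omega) (by push_cast at hNm; omega)
      have h4 := ih (m + 4 - 3) (by omega) (by push_cast at hNm; omega)
      rw [fourthDiff, add_sub_cancel_right] at d
      linear_combination 6 * d - h1 + 4 * h2 - 6 * h3 + 4 * h4
  have h1 := key N n hn (by omega)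
  have h2 := six_mul_finrank_forms (k := k) (n := n) (by omega)
  omega

theorem finrank_map_mulLeft {g : MvPolynomial (Fin 4) k} (h0 : g ≠ 0) (n : ℤ) :
    Module.finrank k ((forms (Fin 4) k n).map (LinearMap.mulLeft k g)) =
      Module.finrank k (forms (Fin 4) k n) :=
  (Submodule.equivMapOfInjective (LinearMap.mulLeft k g) (mul_right_injective₀ h0) _).finrank_eq.symm

theorem map_mulLeft_le {m n : ℤ} {g : MvPolynomial (Fin 4) k} (hg : g ∈ idealPiece I m) :
    (forms (Fin 4) k n).map (LinearMap.mulLeft k g) ≤ idealPiece I (m + n) := by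
  rintro _ ⟨f, hf, rfl⟩
  exact ⟨I.mul_mem_right _ hg.1, mul_mem_forms hg.2 hf⟩

theorem finrank_forms_le_of_mem {m : ℤ} {g : MvPolynomial (Fin 4) k} (hg : g ∈ idealPiece I m)
    (h0 : g ≠ 0) (n : ℤ) :
    Module.finrank k (forms (Fin 4) k n) ≤ Module.finrank k (idealPiece I (m + n)) := by
  rw [← finrank_map_mulLeft h0]
  exact Submodule.finrank_mono (map_mulLeft_le hg)

theorem finrank_idealPiece_span_singleton_le {l : MvPolynomial (Fin 4) k}
    (hl : l ∈ forms (Fin 4) k 1) (h0 : l ≠ 0) (n : ℤ) :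
    Module.finrank k (idealPiece (Ideal.span {l}) n) ≤
      Module.finrank k (forms (Fin 4) k (n - 1)) := by
  rw [← finrank_map_mulLeft h0]
  refine Submodule.finrank_mono ?_
  rintro f ⟨hf, hfn⟩
  obtain ⟨q, hq, rfl⟩ := exists_mem_forms_of_dvd hl hfn (Ideal.mem_span_singleton.1 hf)
  exact ⟨q, hq, rfl⟩

theorem idealPiece_eq_of_finrank {n : ℤ} (h : J ≤ I)
    (hn : Module.finrank k (idealPiece J n) = Module.finrank k (idealPiece I n)) :
    idealPiece J n = idealPiece I n :=
  Submodule.eq_of_le_of_finrank_eq (idealPiece_mono h n) hn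

theorem le_of_isRegular {m : ℕ} (hI : I.IsHomogeneous (homogeneousSubmodule (Fin 4) k))
    (hreg : IsRegular I m) (h : ∀ n : ℕ, n ≤ m → ∀ f ∈ idealPiece I n, f ∈ J) : I ≤ J := by
  obtain ⟨R, hR⟩ := hreg
  have key : ∀ n : ℕ, ∀ f ∈ idealPiece I n, f ∈ J := by
    intro n
    induction n with
    | zero => exact h 0 (Nat.zero_le _)
    | succ n ih =>
      intro f hf
      by_cases hn : n + 1 ≤ m
      · exact h _ hn f hf
      · obtain ⟨g, hg, rfl⟩ := exists_mem_idealPiece_eq_sum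
          (fun j => mem_forms.2 (R.isForm_aug j)) R.range_aug
          (fun j => by have := hR 0 j; push_cast at *; omega) hf
        push_cast at hg
        rw [add_sub_cancel_right] at hg
        exact sum_mem fun i _ => J.mul_mem_left _ (ih _ (hg i))
  exact fun _ hf => mem_of_comp_mem fun n =>
    key n _ ⟨comp_mem_of_isHomogeneous hI hf n, comp_mem _ _⟩

theorem IsRegular.mono {m n : ℤ} (h : IsRegular I m) (hmn : m ≤ n) : IsRegular I n := by
  obtain ⟨R, hR⟩ := h
  exact ⟨R, fun i j => (hR i j).trans (by omega)⟩

theorem hasRegularity_three (h3 : IsRegular I 3) (h2 : ¬ IsRegular I 2) : HasRegularity I 3 :=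
  ⟨h3, fun m hm => by
    by_contra h
    exact h2 (hm.mono (by omega))⟩

/-- With shifts at most 4 and n ≥ 1, all degrees involved are at least -3, where dimensions are
given by the cubic polynomial. -/
theorem ShortResolution.hasHilbertPolynomial {r s : ℕ} {a : Fin r → ℤ} {b : Fin s → ℤ}
    (R : ShortResolution I a b) (ha : ∀ j, a j ≤ 4) (hb : ∀ j, b j ≤ 4)
    (h : ∀ n : ℤ, (n + 3) * (n + 2) * (n + 1) -
      ∑ j, (n - a j + 3) * (n - a j + 2) * (n - a j + 1) +
      ∑ j, (n - b j + 3) * (n - b j + 2) * (n - b j + 1) = 24 * n) :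
    HasHilbertPolynomial I (Polynomial.C 4 * Polynomial.X) := by
  rw [hasHilbertPolynomial_iff]
  filter_upwards [eventually_ge_atTop 1] with n hn
  have h1 := R.sum_finrank n
  have h2 := h n
  have h3 := six_mul_finrank_forms (k := k) (n := n) (by omega)
  have ha' := fun j => six_mul_finrank_forms (k := k) (n := n - a j) (by have := ha j; omega)
  have hb' := fun j => six_mul_finrank_forms (k := k) (n := n - b j) (by have := hb j; omega)
  simp only [← ha', ← hb', ← h3, ← Finset.mul_sum] at h2
  zify at h1
  omega

end HilbertPolynomial

/-! ### Complete intersections of two quadrics -/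

section CompleteIntersection

variable {k : Type*} [Field k] {I : Ideal (MvPolynomial (Fin 4) k)}

/-- The syzygies of two coprime quadrics are not generated in degree three. -/
theorem not_isRegular_two_of_isRelPrime {f g : MvPolynomial (Fin 4) k}
    (hf : f ∈ forms (Fin 4) k 2) (hg : g ∈ forms (Fin 4) k 2) (h : IsRelPrime f g) :
    ¬ IsRegular (Ideal.span {f, g}) 2 := by
  rintro ⟨R, hR⟩
  have haug : ∀ j, R.aug (Pi.single j 1) ∈ forms (Fin 4) k (R.deg 0 j) :=
    fun j => mem_forms.2 (R.isForm_aug j)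
  have hc : ∀ n u, comp n (R.aug u) = R.aug (vcomp (R.deg 0) n u) := fun n u => by
    simpa using comp_apply_of_forms (b := 0) (by simpa using haug) n u
  have hlift : ∀ q ∈ forms (Fin 4) k 2, q ∈ Ideal.span {f, g} →
      ∃ u ∈ piece (R.deg 0) 2, R.aug u = q := fun q hq hqI => by
    rw [← R.range_aug] at hqI
    obtain ⟨u, rfl⟩ := hqI
    exact ⟨_, vcomp_mem _ 2 u, by rw [← hc, comp_of_mem hq]⟩
  obtain ⟨F, hF, hFf⟩ := hlift f hf (Ideal.subset_span (by simp))
  obtain ⟨G, hG, hGg⟩ := hlift g hg (Ideal.subset_span (by simp))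
  -- The resolution is arbitrary, so it is compared with the Koszul complex: φ and ψ below record
  -- coefficients of f and g, and φ lowers degrees by 2.
  have hcoef : ∀ j, ∃ c ∈ forms (Fin 4) k (R.deg 0 j - 2), ∃ d,
      R.aug (Pi.single j 1) = c * f + d * g := fun j => by
    have h1 : R.aug (Pi.single j 1) ∈ Ideal.span {f, g} := by
      have h2 : R.aug (Pi.single j 1) ∈ LinearMap.range R.aug := ⟨_, rfl⟩
      rwa [R.range_aug] at h2
    obtain ⟨c, d, hcd⟩ := Ideal.mem_span_pair.1 h1
    refine ⟨comp (R.deg 0 j - 2) c, comp_mem _ _, comp (R.deg 0 j - 2) d, ?_⟩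
    have e1 := comp_mul hf (R.deg 0 j - 2) c
    have e2 := comp_mul hg (R.deg 0 j - 2) d
    rw [sub_add_cancel] at e1 e2
    rw [mul_comm _ f, mul_comm _ g, ← e1, ← e2, ← map_add, mul_comm f, mul_comm g, hcd,
      comp_of_mem (haug j)]
  choose c hc2 d hcd using hcoef
  let φ := Fintype.linearCombination (MvPolynomial (Fin 4) k) c
  let ψ := Fintype.linearCombination (MvPolynomial (Fin 4) k) d
  have hφψ : ∀ u, R.aug u = φ u * f + ψ u * g := fun u => by
    conv_lhs => rw [pi_eq_sum_univ' u]
    simp only [map_sum, map_smul, hcd, φ, ψ, Fintype.linearCombination_apply, Finset.sum_mul,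
      ← Finset.sum_add_distrib, smul_eq_mul]
    exact Finset.sum_congr rfl fun j _ => by ring
  have hφ : ∀ n, ∀ u ∈ piece (R.deg 0) n, φ u ∈ forms (Fin 4) k (n - 2) := fun n u hu => by
    rw [← vcomp_of_mem hu, ← comp_apply_of_forms (b := 2)]
    · exact comp_mem _ _
    · intro j
      simpa [φ, Fintype.linearCombination_apply_single] using hc2 j
  -- If syzygies were generated in degrees at most 3, the Koszul syzygy of degree 4 would be a
  -- combination of cubic ones.
  obtain ⟨v, hv, hv3, hsum⟩ := exists_mem_range_eq_sum (u := g • F - f • G) (n := 4)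
    (fun j l => mem_forms.2 (R.isForm_d 0 j l)) (fun j => (hR 1 j).trans_lt (by norm_num))
    (by
      rw [R.exact_zero, LinearMap.mem_ker, map_sub, map_smul, map_smul, hFf, hGg, smul_eq_mul,
        smul_eq_mul]
      ring)
    (by
      refine sub_mem (mem_piece.2 fun j => ?_) (mem_piece.2 fun j => ?_)
      · rw [show 4 - R.deg 0 j = 2 + (2 - R.deg 0 j) by ring]
        exact mul_mem_forms hg (mem_piece.1 hF j)
      · rw [show 4 - R.deg 0 j = 2 + (2 - R.deg 0 j) by ring]
        exact mul_mem_forms hf (mem_piece.1 hG j))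
  -- By coprimality g divides φ (v i), which has degree 1.
  have hv0 : ∀ i, φ (v i) = 0 := fun i => by
    have h1 := hv i
    rw [R.exact_zero, LinearMap.mem_ker, hφψ] at h1
    refine eq_zero_of_dvd_of_lt hg (hφ _ _ (hv3 i)) ?_ (by norm_num)
    exact h.symm.dvd_of_dvd_mul_right ⟨-ψ (v i), by linear_combination h1⟩
  have h1 : g * φ F - f * φ G = 0 := by
    rw [← smul_eq_mul, ← smul_eq_mul, ← map_smul, ← map_smul, ← map_sub, hsum, map_sum]
    exact Finset.sum_eq_zero fun i _ => by rw [map_smul, hv0, smul_zero]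
  -- Here f divides a constant. Then f is a multiple of g, contradicting coprimality.
  have h2 : φ F = 0 := by
    refine eq_zero_of_dvd_of_lt hf (hφ _ _ hF) ?_ (by norm_num)
    exact h.dvd_of_dvd_mul_left ⟨φ G, by linear_combination h1⟩
  have h3 := hφψ F
  rw [hFf, h2, zero_mul, zero_add] at h3
  exact not_isUnit_of_mem_forms two_pos hg (h ⟨ψ F, h3.trans (mul_comm _ _)⟩ dvd_rfl)

theorem properties_of_isRelPrime {f g : MvPolynomial (Fin 4) k}
    (hf : f ∈ forms (Fin 4) k 2) (hg : g ∈ forms (Fin 4) k 2) (h : IsRelPrime f g) :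
    (Ideal.span {f, g}).IsHomogeneous (homogeneousSubmodule (Fin 4) k) ∧
      IsSaturated (Ideal.span {f, g}) ∧
      HasHilbertPolynomial (Ideal.span {f, g}) (Polynomial.C 4 * Polynomial.X) ∧
      HasRegularity (Ideal.span {f, g}) 3 := by
  have hf0 : f ≠ 0 := by
    rintro rfl
    exact not_isUnit_of_mem_forms two_pos hg (h (dvd_zero g) dvd_rfl)
  have R := pairResolution (c := 1) (e := 0)
    (mem_forms_natCast (n := 0).2 (isHomogeneous_one _ _)) hf hg one_ne_zero hf0 h
  rw [one_mul, one_mul] at R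
  refine ⟨R.isHomogeneous, R.isSaturated, R.hasHilbertPolynomial ?_ ?_ ?_, hasRegularity_three
    (R.isRegular ?_ ?_) (not_isRegular_two_of_isRelPrime hf hg h)⟩
  · simp [Fin.forall_fin_two]
  · simp
  · intro n
    simp [Fin.sum_univ_two]
    ring
  · simp [Fin.forall_fin_two]
  · simp

end CompleteIntersection

/-! ### Ideals with a linear common factor in degree two -/

section Cubic

variable {k : Type*} [Field k] {I : Ideal (MvPolynomial (Fin 4) k)}

theorem finrank_idealPiece_span_pair {l l₁ l₂ : MvPolynomial (Fin 4) k}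
    (hl : l ∈ forms (Fin 4) k 1) (hl₁ : l₁ ∈ forms (Fin 4) k 1) (hl₂ : l₂ ∈ forms (Fin 4) k 1)
    (hl0 : l ≠ 0) (h : LinearIndependent k ![l₁, l₂]) (n : ℤ) :
    Module.finrank k (forms (Fin 4) k (n - 2)) + Module.finrank k (forms (Fin 4) k (n - 2)) =
      Module.finrank k (forms (Fin 4) k (n - 3)) +
        Module.finrank k (idealPiece (Ideal.span {l * l₁, l * l₂}) n) := by
  have h1 := (pairResolution hl hl₁ hl₂ hl0 (h.ne_zero 0)
    (isRelPrime_of_linearIndependent hl₁ hl₂ h)).sum_finrank n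
  rw [Fin.sum_univ_two, Fin.sum_univ_one] at h1
  exact h1

theorem properties_of_cubic {l l₁ l₂ f : MvPolynomial (Fin 4) k}
    (hl : l ∈ forms (Fin 4) k 1) (hl₁ : l₁ ∈ forms (Fin 4) k 1) (hl₂ : l₂ ∈ forms (Fin 4) k 1)
    (hf : f ∈ forms (Fin 4) k 3) (hl0 : l ≠ 0) (h : LinearIndependent k ![l₁, l₂])
    (hfI : f ∈ Ideal.span {l₁, l₂}) (hlf : ¬ l ∣ f) :
    (Ideal.span {l * l₁, l * l₂, f}).IsHomogeneous (homogeneousSubmodule (Fin 4) k) ∧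
      IsSaturated (Ideal.span {l * l₁, l * l₂, f}) ∧
      HasHilbertPolynomial (Ideal.span {l * l₁, l * l₂, f}) (Polynomial.C 4 * Polynomial.X) ∧
      HasRegularity (Ideal.span {l * l₁, l * l₂, f}) 3 := by
  obtain ⟨A, hA, B, hB, rfl⟩ : ∃ A ∈ forms (Fin 4) k 2, ∃ B ∈ forms (Fin 4) k 2,
      f = A * l₁ + B * l₂ := by
    obtain ⟨A, B, rfl⟩ := Ideal.mem_span_pair.1 hfI
    refine ⟨comp 2 A, comp_mem _ _, comp 2 B, comp_mem _ _, ?_⟩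
    have e1 := comp_mul hl₁ 2 A
    have e2 := comp_mul hl₂ 2 B
    rw [← comp_of_mem hf, map_add, mul_comm A, mul_comm B, mul_comm _ l₁, mul_comm _ l₂, ← e1, ← e2]
    rfl
  have R := cubicResolution hl hl₁ hl₂ hA hB hl0 h hlf
  refine ⟨R.isHomogeneous, R.isSaturated, R.hasHilbertPolynomial ?_ ?_ ?_, hasRegularity_three
    (R.isRegular ?_ ?_) fun hreg => hlf ?_⟩
  · simp [Fin.forall_fin_succ]
  · simp [Fin.forall_fin_two]
  · intro n
    simp [Fin.sum_univ_two, Fin.sum_univ_three]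
    ring
  · simp [Fin.forall_fin_succ]
  · simp [Fin.forall_fin_two]
  -- A 2-regular ideal is generated in degrees at most 2, where this one agrees with J and so lies
  -- in (l); then l would divide the cubic.
  · have hJn := fun n : ℕ => finrank_idealPiece_span_pair hl hl₁ hl₂ hl0 h n
    set J := Ideal.span {l * l₁, l * l₂}
    have hJ : J ≤ Ideal.span {l} := by
      refine Ideal.span_le.2 ?_
      rintro _ (rfl | rfl)
      · exact Ideal.mem_span_singleton.2 ⟨_, rfl⟩
      · exact Ideal.mem_span_singleton.2 ⟨_, rfl⟩
    have hJI : J ≤ Ideal.span {l * l₁, l * l₂, A * l₁ + B * l₂} :=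
      Ideal.span_mono (by intro x; simp; tauto)
    have hle := le_of_isRegular (m := 2) (J := Ideal.span {l}) R.isHomogeneous hreg ?_
    · exact Ideal.mem_span_singleton.1 (hle (Ideal.subset_span (by simp)))
    intro n hn f hf
    have h1 : Module.finrank k (forms (Fin 4) k (n - 2)) +
        Module.finrank k (forms (Fin 4) k (n - 2)) + Module.finrank k (forms (Fin 4) k (n - 3)) =
        Module.finrank k (forms (Fin 4) k (n - 3)) + Module.finrank k (forms (Fin 4) k (n - 4)) +
        Module.finrank k
          (idealPiece (Ideal.span {l * l₁, l * l₂, A * l₁ + B * l₂}) n) := by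
      have h1 := R.sum_finrank n
      rw [Fin.sum_univ_two, Fin.sum_univ_three] at h1
      exact h1
    have h2 := hJn n
    rw [← idealPiece_eq_of_finrank hJI] at hf
    · exact hJ hf.1
    have e₃ : Module.finrank k (forms (Fin 4) k ((n : ℤ) - 3)) = 0 := by
      rw [forms_of_neg (by omega), finrank_bot]
    have e₄ : Module.finrank k (forms (Fin 4) k ((n : ℤ) - 4)) = 0 := by
      rw [forms_of_neg (by omega), finrank_bot]
    omega

end Cubic
-- Generators from the Hilbert function
section Classification

variable {k : Type*} [Field k] {I : Ideal (MvPolynomial (Fin 4) k)}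

theorem exists_generators_of_finrank (hI : I.IsHomogeneous (homogeneousSubmodule (Fin 4) k))
    (hreg : IsRegular I 3)
    (H : ∀ n : ℤ, 2 ≤ n → (Module.finrank k (idealPiece I n) : ℤ) =
      Module.finrank k (forms (Fin 4) k n) - 4 * n) :
    (∃ f ∈ forms (Fin 4) k 2, ∃ g ∈ forms (Fin 4) k 2, IsRelPrime f g ∧ I = Ideal.span {f, g}) ∨
    ∃ l ∈ forms (Fin 4) k 1, ∃ l₁ ∈ forms (Fin 4) k 1, ∃ l₂ ∈ forms (Fin 4) k 1,
      ∃ f ∈ forms (Fin 4) k 3, l ≠ 0 ∧ LinearIndependent k ![l₁, l₂] ∧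
        f ∈ Ideal.span {l₁, l₂} ∧ ¬ l ∣ f ∧ I = Ideal.span {l * l₁, l * l₂, f} := by
  have p_neg : Module.finrank k (forms (Fin 4) k (-1)) = 0 := by
    rw [forms_of_neg (by norm_num), finrank_bot]
  have p0 := six_mul_finrank_forms (k := k) (n := 0) (by norm_num)
  have p1 := six_mul_finrank_forms (k := k) (n := 1) (by norm_num)
  have p2 := six_mul_finrank_forms (k := k) (n := 2) (by norm_num)
  have p3 := six_mul_finrank_forms (k := k) (n := 3) (by norm_num)
  have p4 := six_mul_finrank_forms (k := k) (n := 4) (by norm_num)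
  have H2 := H 2 (by norm_num)
  have H3 := H 3 (by norm_num)
  have H4 := H 4 (by norm_num)
  -- The ideal has dimensions 10 - 8 = 2, 20 - 12 = 8 and 35 - 16 = 19 in degrees 2, 3, 4.
  norm_num at p0 p1 p2 p3 p4 H2 H3 H4
  have hlow : ∀ n : ℕ, n ≤ 1 → ∀ f ∈ idealPiece I n, f = 0 := fun n hn f hf => by
    by_contra h0
    -- A nonzero form of degree at most 1 would have at least a 4-dimensional space of multiples in
    -- degree 2.
    have h1 := finrank_forms_le_of_mem hf h0 (2 - n)
    rw [add_sub_cancel] at h1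
    interval_cases n
    · change Module.finrank k (forms (Fin 4) k 2) ≤ _ at h1
      omega
    · change Module.finrank k (forms (Fin 4) k 1) ≤ _ at h1
      omega
  have hle : ∀ J : Ideal (MvPolynomial (Fin 4) k), idealPiece I 2 ≤ J.restrictScalars k →
      idealPiece I 3 ≤ J.restrictScalars k → I ≤ J := fun J h2 h3 =>
    le_of_isRegular (m := 3) hI hreg fun n hn f hf => by
      rcases Nat.lt_or_ge 1 n with h1 | h1
      · obtain rfl | rfl : n = 2 ∨ n = 3 := by omega
        · exact h2 hf
        · exact h3 hf
      · rw [hlow n h1 f hf]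
        exact zero_mem J
  obtain ⟨p, hp, q, hq, hpq⟩ : ∃ p ∈ idealPiece I 2, ∃ q ∈ idealPiece I 2,
      LinearIndependent k ![p, q] := by
    let b := Module.finBasisOfFinrankEq k (idealPiece I 2) (n := 2) (by omega)
    refine ⟨b 0, (b 0).2, b 1, (b 1).2, ?_⟩
    have h := b.linearIndependent.map' _ (Submodule.ker_subtype (idealPiece I 2))
    have he : (![(b 0 : MvPolynomial (Fin 4) k), (b 1 : MvPolynomial (Fin 4) k)]) =
        (idealPiece I 2).subtype ∘ b := by
      ext1 i
      fin_cases i <;> rfl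
    rw [he]
    exact h
  by_cases hrel : IsRelPrime p q
  · refine Or.inl ⟨p, hp.2, q, hq.2, hrel, ?_⟩
    have hJI : Ideal.span {p, q} ≤ I := Ideal.span_le.2 (by
      rintro _ (rfl | rfl)
      · exact hp.1
      · exact hq.1)
    have R := pairResolution (c := 1) (e := 0)
      (mem_forms_natCast (n := 0).2 (isHomogeneous_one _ _)) hp.2 hq.2 one_ne_zero
      (hpq.ne_zero 0) hrel
    rw [one_mul, one_mul] at R
    have hJ : ∀ n : ℤ, n < 4 →
        Module.finrank k (forms (Fin 4) k (n - 2)) + Module.finrank k (forms (Fin 4) k (n - 2)) =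
          Module.finrank k (idealPiece (Ideal.span {p, q}) n) := fun n hn => by
      have h1 := R.sum_finrank n
      rw [Fin.sum_univ_two, Fin.sum_univ_one] at h1
      have h2 : Module.finrank k (forms (Fin 4) k (n - (0 + 2 * 2))) = 0 := by
        rw [forms_of_neg (by omega), finrank_bot]
      refine (h1.trans (congrArg (· + _) h2)).trans (zero_add _)
    have hJ2 : Module.finrank k (forms (Fin 4) k 0) + Module.finrank k (forms (Fin 4) k 0) = _ :=
      hJ 2 (by norm_num)
    have hJ3 : Module.finrank k (forms (Fin 4) k 1) + Module.finrank k (forms (Fin 4) k 1) = _ :=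
      hJ 3 (by norm_num)
    refine le_antisymm (hle _ ?_ ?_) hJI
    · rw [← idealPiece_eq_of_finrank hJI (by omega)]
      exact inf_le_left
    · rw [← idealPiece_eq_of_finrank hJI (by omega)]
      exact inf_le_left
  obtain ⟨l, hl, l₁, hl₁, l₂, hl₂, rfl, rfl⟩ := exists_common_factor hp.2 hq.2 hpq hrel
  have hl0 : l ≠ 0 := left_ne_zero_of_mul (hpq.ne_zero 0)
  have hind : LinearIndependent k ![l₁, l₂] := by
    rw [LinearIndependent.pair_iff] at hpq ⊢
    intro s t hst
    refine hpq s t ?_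
    rw [← mul_smul_comm, ← mul_smul_comm, ← mul_add, hst, mul_zero]
  have hJn := fun n => finrank_idealPiece_span_pair hl hl₁ hl₂ hl0 hind n
  have hJI : Ideal.span {l * l₁, l * l₂} ≤ I := Ideal.span_le.2 (by
    rintro _ (rfl | rfl)
    · exact hp.1
    · exact hq.1)
  have hJ2 : Module.finrank k (forms (Fin 4) k 0) + Module.finrank k (forms (Fin 4) k 0) =
      Module.finrank k (forms (Fin 4) k (-1)) + _ := hJn 2
  have hJ3 : Module.finrank k (forms (Fin 4) k 1) + Module.finrank k (forms (Fin 4) k 1) =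
      Module.finrank k (forms (Fin 4) k 0) + _ := hJn 3
  have hJ4 : Module.finrank k (forms (Fin 4) k 2) + Module.finrank k (forms (Fin 4) k 2) =
      Module.finrank k (forms (Fin 4) k 1) + _ := hJn 4
  obtain ⟨f, hf, hfJ⟩ : ∃ f ∈ idealPiece I 3, f ∉ idealPiece (Ideal.span {l * l₁, l * l₂}) 3 := by
    by_contra! h
    have := Submodule.finrank_mono h
    omega
  have hIJ : I = Ideal.span {l * l₁, l * l₂, f} := by
    have hJf : Ideal.span {l * l₁, l * l₂} ≤ Ideal.span {l * l₁, l * l₂, f} :=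
      Ideal.span_mono (by intro x; simp; tauto)
    refine le_antisymm (hle _ ?_ ?_) (Ideal.span_le.2 ?_)
    · rw [← idealPiece_eq_of_finrank hJI (by omega)]
      exact fun x hx => hJf hx.1
    · have h1 : idealPiece (Ideal.span {l * l₁, l * l₂}) 3 <
          idealPiece (Ideal.span {l * l₁, l * l₂, f}) 3 :=
        lt_of_le_of_ne (idealPiece_mono hJf 3) fun h =>
          hfJ (h ▸ ⟨Ideal.subset_span (by simp), hf.2⟩)
      have h2 := Submodule.finrank_lt_finrank_of_lt h1
      have h3 : Ideal.span {l * l₁, l * l₂, f} ≤ I := by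
        refine Ideal.span_le.2 ?_
        rintro _ (rfl | rfl | rfl)
        exacts [hp.1, hq.1, hf.1]
      have h4 := Submodule.finrank_mono (idealPiece_mono h3 3)
      rw [← idealPiece_eq_of_finrank h3 (by omega)]
      exact inf_le_left
    · rintro _ (rfl | rfl | rfl)
      exacts [hp.1, hq.1, hf.1]
  have hlf : ¬ l ∣ f := by
    intro h
    have hIl : I ≤ Ideal.span {l} := by
      rw [hIJ, Ideal.span_le]
      rintro _ (rfl | rfl | rfl)
      exacts [Ideal.mem_span_singleton.2 ⟨_, rfl⟩, Ideal.mem_span_singleton.2 ⟨_, rfl⟩,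
        Ideal.mem_span_singleton.2 h]
    -- Degree 10 is large enough: the ideal has dimension 286 - 40 = 246 there, while (l) has only
    -- 220. Any degree from 5 on would do.
    have h1 : _ ≤ Module.finrank k (forms (Fin 4) k 9) :=
      (Submodule.finrank_mono (idealPiece_mono hIl 10)).trans
      (finrank_idealPiece_span_singleton_le hl hl0 10)
    have h2 := H 10 (by norm_num)
    have p9 := six_mul_finrank_forms (k := k) (n := 9) (by norm_num)
    have p10 := six_mul_finrank_forms (k := k) (n := 10) (by norm_num)
    norm_num at h2 p9 p10
    omega
  refine Or.inr ⟨l, hl, l₁, hl₁, l₂, hl₂, f, hf.2, hl0, hind, ?_, hlf, hIJ⟩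
  have hf0 : f ≠ 0 := fun h => hlf (h ▸ dvd_zero l)
  have hfle : (forms (Fin 4) k 1).map (LinearMap.mulLeft k f) ≤ idealPiece I 4 :=
    map_mulLeft_le (m := 3) (n := 1) hf
  have h1 := Submodule.finrank_mono (sup_le (idealPiece_mono hJI 4) hfle)
  have h2 := Submodule.finrank_sup_add_finrank_inf_eq (idealPiece (Ideal.span {l * l₁, l * l₂}) 4)
    ((forms (Fin 4) k 1).map (LinearMap.mulLeft k f))
  rw [finrank_map_mulLeft hf0] at h2
  -- Inside the 19-dimensional quartic part of I, subspaces of dimensions 16 and 4 must meet.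
  obtain ⟨_, ⟨hγJ, γ, hγ, rfl⟩, hγ0⟩ := Submodule.exists_mem_ne_zero_of_ne_bot
    (p := idealPiece (Ideal.span {l * l₁, l * l₂}) 4 ⊓
      (forms (Fin 4) k 1).map (LinearMap.mulLeft k f)) (by
        intro h
        rw [h, finrank_bot] at h2
        omega)
  rw [LinearMap.mulLeft_apply] at hγ0 hγJ
  obtain ⟨s, t, hst⟩ := Ideal.mem_span_pair.1 hγJ.1
  -- The multiple f γ is divisible by the prime l, which does not divide f, so γ is a scalar
  -- multiple of l and l can be cancelled.
  obtain ⟨c, hc, rfl⟩ := exists_mem_forms_of_dvd hl hγ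
    (((prime_of_mem_forms_one hl hl0).dvd_or_dvd
      ⟨s * l₁ + t * l₂, by rw [← hst]; ring⟩).resolve_left hlf)
  obtain ⟨c, rfl⟩ := exists_eq_C_of_mem_forms_zero (by simpa using hc)
  have hc0 : c ≠ 0 := by
    rintro rfl
    simp at hγ0
  refine Ideal.mem_span_pair.2 ⟨C c⁻¹ * s, C c⁻¹ * t, mul_left_cancel₀ hl0 ?_⟩
  have hcc : (C c⁻¹ * C c : MvPolynomial (Fin 4) k) = 1 := by
    rw [← C_mul, inv_mul_cancel₀ hc0, C_1]
  linear_combination C c⁻¹ * hst + l * f * hcc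

end Classification
end ProjIdeal

theorem proposition2p1 {k : Type*} [Field k] [IsAlgClosed k] [CharZero k]
    (I : Ideal (MvPolynomial (Fin 4) k)) :
    (I.IsHomogeneous (homogeneousSubmodule (Fin 4) k) ∧
      ProjIdeal.IsSaturated I ∧
      ProjIdeal.HasHilbertPolynomial I (Polynomial.C 4 * Polynomial.X) ∧
      ProjIdeal.HasRegularity I 3) ↔
    ((∃ f g : MvPolynomial (Fin 4) k, f.IsHomogeneous 2 ∧ g.IsHomogeneous 2 ∧
        IsRelPrime f g ∧ I = Ideal.span {f, g}) ∨
      (∃ l l₁ l₂ f : MvPolynomial (Fin 4) k,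
        l.IsHomogeneous 1 ∧ l₁.IsHomogeneous 1 ∧ l₂.IsHomogeneous 1 ∧ f.IsHomogeneous 3 ∧
        l ≠ 0 ∧ LinearIndependent k ![l₁, l₂] ∧
        f ∈ Ideal.span {l₁, l₂} ∧ ¬ l ∣ f ∧
        I = Ideal.span {l * l₁, l * l₂, f})) := by
  have hform : ∀ (n : ℕ) (f : MvPolynomial (Fin 4) k),
      f ∈ ProjIdeal.forms (Fin 4) k n ↔ f.IsHomogeneous n := fun _ _ => ProjIdeal.mem_forms_natCast
  constructor
  · rintro ⟨hI, hsat, hp, hreg⟩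
    rcases ProjIdeal.exists_generators_of_finrank hI hreg.1
      fun n => ProjIdeal.finrank_idealPiece_of_isRegular_three hsat hreg.1 hp with
      ⟨f, hf, g, hg, h⟩ | ⟨l, hl, l₁, hl₁, l₂, hl₂, f, hf, h⟩
    · exact Or.inl ⟨f, g, (hform 2 f).1 hf, (hform 2 g).1 hg, h⟩
    · exact Or.inr ⟨l, l₁, l₂, f, (hform 1 l).1 hl, (hform 1 l₁).1 hl₁, (hform 1 l₂).1 hl₂,
        (hform 3 f).1 hf, h⟩
  · rintro (⟨f, g, hf, hg, h, rfl⟩ | ⟨l, l₁, l₂, f, hl, hl₁, hl₂, hf, hl0, hind, hfI, hlf, rfl⟩)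
    · exact ProjIdeal.properties_of_isRelPrime ((hform 2 f).2 hf) ((hform 2 g).2 hg) h
    · exact ProjIdeal.properties_of_cubic ((hform 1 l).2 hl) ((hform 1 l₁).2 hl₁)
        ((hform 1 l₂).2 hl₂) ((hform 3 f).2 hf) hl0 hind hfI hlf
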